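/- Notation. Let $n\ge 2$ and let $\mathcal T$ be a vector addition system of dimension $n$, i.e. a finite set of vectors ("transitions") in $\mathbb Z^n$. Write $\|\mathcal T\|=\max\{|b(i)| : b\in\mathcal T,\ 1\le i\le n\}$ and $\mathrm{pic}(\mathcal T)=\max\{\max(0,-b(i)) : b\in\mathcal T,\ 1\le i\le n\}$, and assume $\mathrm{pic}(\mathcal T)\ge 1$. A pseudo-run is a sequence $u_0,\dots,u_k$ ($k\ge 0$) in $\mathbb Z^n$ with $u_m=u_{m-1}+t_m$, $t_m\in\mathcal T$, for $1\le m\le k$; its length is $k+1$. An interval is an expression $]-\infty,+\infty[$, $[a,+\infty[$, $]-\infty,b]$ or $[a,b]$ with $a,b\in\mathbb Z$. A generalized unboundedness property $\mathcal P=(\mathcal I_1,\dots,\mathcal I_K)$ is a sequence of length $K\ge 1$ of $n$-tuples of intervals; its scale $\|\mathcal P\|$ is the maximum of $1$ and of the absolute values of the integers occurring in its interval expressions. For $1\le l\le K$ and $\mathrm{INCR},I\subseteq\{1,\dots,n\}$, a pseudo-run satisfies $\mathcal A[\mathcal P,l,\mathrm{INCR},I,+\infty]$ if there are positions $0=f(2l-2)\le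 f(2l-1)\le\dots\le f(2K)=k$ such that, with $y_i=u_{f(i)}$ and $d_{l'}(j)=y_{2l'}(j)-y_{2l'-1}(j)$: 1. $d_{l'}(j)\in\mathcal I_{l'}(j)$ for all $l\le l'\le K$ and $1\le j\le n$; 2. for all $l\le l'\le K$ and $1\le j\le n$, if $d_{l'}(j)<0$ then $j\in\mathrm{INCR}$ or $d_{l''}(j)>0$ for some $l\le l''<l'$; 3. for all $l-1\le l'\le K$, all positions $m$ with $f(2l')\le m<f(2l'+2)$ (for $l'=K$: $m=k$), and all $j\in I\setminus(\mathrm{INCR}\cup\{j : d_{l''}(j)>0 \text{ for some } l\le l''\le l'\})$, we have $u_m(j)\ge 0$. For a natural number $C_1$ put $\mu=(1+K)\cdot\|\mathcal T\|\cdot\|\mathcal P\|$ and $$g(0)=(2\mu)^{n^{C_1}},\qquad g(i)=\bigl(2\mu\,(\mathrm{pic}(\mathcal T)\, g(i-1))\bigr)^{n^{C_1}}+g(i-1)\quad(i>0).$$ Statement. There is a constant $C_1\in\mathbb N$ (independent of $n$, $\mathcal T$, $\mathcal P$, $K$, $l$, $\mathrm{INCR}$, $I$ and of the pseudo-run) such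 that for all $n$, $\mathcal T$, $\mathcal P$, $l$, $\mathrm{INCR}$, $I$ as above: if a pseudo-run $\rho$ of $\mathcal T$ satisfies $\mathcal A[\mathcal P,l,\mathrm{INCR},I,+\infty]$, then there is a pseudo-run $\rho'$ of $\mathcal T$ that starts from the same pseudo-configuration as $\rho$, satisfies $\mathcal A[\mathcal P,l,\mathrm{INCR},I,+\infty]$ and has length at most $g(|I|)$. -/

import Mathlib

namespace VAS

/-- Expressions for intervals of integers:
`]-∞,+∞[`, `[a,+∞[`, `]-∞,b]` and `[a,b]`, with `a b : ℤ`. -/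
inductive IntervalExpr where
  | univ : IntervalExpr
  | ici (a : ℤ) : IntervalExpr
  | iic (b : ℤ) : IntervalExpr
  | icc (a b : ℤ) : IntervalExpr

/-- The set of integers denoted by an interval expression. -/
def IntervalExpr.toSet : IntervalExpr → Set ℤ
  | .univ => Set.univ
  | .ici a => Set.Ici a
  | .iic b => Set.Iic b
  | .icc a b => Set.Icc a b

/-- The maximal absolute value of the integers occurring in an interval expression
(`0` if there are none). -/
def IntervalExpr.maxAbs : IntervalExpr → ℕ
  | .univ => 0
  | .ici a => a.natAbs
  | .iic b => b.natAbs
  | .icc a b => max a.natAbs b.natAbs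

/-- A generalized unboundedness property `(𝓘₁, …, 𝓘_K)` in dimension `n`: a nonempty sequence of
`n`-tuples of intervals. `P.K` is its length, and `P.interval ⟨l, _⟩` is the tuple `𝓘_l`. -/
structure GenUnbProp (n : ℕ) where
  /-- the length of the property -/
  K : ℕ
  one_le_K : 1 ≤ K
  /-- the tuples of intervals, indexed by `1, …, K` -/
  interval : Finset.Icc 1 K → Fin n → IntervalExpr

/-- The scale of a generalized unboundedness property: the maximum of `1` and of the absolute
values of the integers occurring in its interval expressions. -/
def GenUnbProp.scale {n : ℕ} (P : GenUnbProp n) : ℕ :=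
  max 1 (Finset.univ.sup fun l : Finset.Icc 1 P.K =>
    Finset.univ.sup fun j : Fin n => (P.interval l j).maxAbs)

/-- The maximal absolute value of an entry of a transition of the VAS `T`. -/
def absMax {n : ℕ} (T : Finset (Fin n → ℤ)) : ℕ :=
  T.sup fun b => Finset.univ.sup fun i : Fin n => (b i).natAbs

/-- The maximum over the transitions `b` of the VAS `T` and the components `i` of
`max 0 (-b i)`. -/
def maxDec {n : ℕ} (T : Finset (Fin n → ℤ)) : ℕ :=
  T.sup fun b => Finset.univ.sup fun i : Fin n => (-(b i)).toNat

/-- A pseudo-run of the VAS `T` (a finite set of vectors in `ℤⁿ`): it is induced by a path, i.e.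
a finite sequence of transitions, from an initial pseudo-configuration in `ℤⁿ`. -/
structure PseudoRun {n : ℕ} (T : Finset (Fin n → ℤ)) where
  /-- the initial pseudo-configuration -/
  initial : Fin n → ℤ
  /-- the inducing path -/
  path : List (Fin n → ℤ)
  path_mem : ∀ t ∈ path, t ∈ T

namespace PseudoRun

variable {n : ℕ} {T : Finset (Fin n → ℤ)}

/-- The pseudo-configurations `u₀, …, u_k` of a pseudo-run whose path has `k` transitions. -/
def config (ρ : PseudoRun T) (m : ℕ) : Fin n → ℤ :=
  ρ.initial + (ρ.path.take m).sum

/-- The length of a pseudo-run is its number of pseudo-configurations. -/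
def length (ρ : PseudoRun T) : ℕ := ρ.path.length + 1

/-- `f` presents the pseudo-run in the form
`y_{2l-2} ⟶ y_{2l-1} ⟶ y_{2l} ⟶ ⋯ ⟶ y_{2K-1} ⟶ y_{2K}`,
where `f i` is the position of `y_i` along the pseudo-run. -/
def IsDecomposition (ρ : PseudoRun T) (l K : ℕ) (f : ℕ → ℕ) : Prop :=
  f (2 * l - 2) = 0 ∧ f (2 * K) = ρ.path.length ∧ MonotoneOn f (Set.Icc (2 * l - 2) (2 * K))

/-- The difference `y_{2l'}(j) - y_{2l'-1}(j)`, for `y_i` at position `f i`. -/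
def diff (ρ : PseudoRun T) (f : ℕ → ℕ) (l' : ℕ) (j : Fin n) : ℤ :=
  ρ.config (f (2 * l')) j - ρ.config (f (2 * l' - 1)) j

/-- The pseudo-run satisfies the approximation property `𝓐[P, l, INCR, I, B]`; `B = ⊤` is the
case `B = +∞`. It is required to admit a decomposition such that:
* for `l' ∈ [l, K]`, the difference of `y_{2l'}` and `y_{2l'-1}` lies in the intervals of `𝓘_{l'}`;
* a component may decrease from `y_{2l'-1}` to `y_{2l'}` only if it is in `INCR` or
  increases from `y_{2l''-1}` to `y_{2l''}` for some `l ≤ l'' < l'`;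
* for `l' ∈ [l-1, K]`, at the positions from that of `y_{2l'}` and strictly before that of
  `y_{2l'+2}` (for `l' = K`: at the last position), every component of `I` that is neither in
  `INCR` nor increased from `y_{2l''-1}` to `y_{2l''}` for some `l ≤ l'' ≤ l'`
  has a value in `[0, B-1]` (in `ℕ` when `B = +∞`). -/
def SatisfiesApprox (ρ : PseudoRun T) (P : GenUnbProp n) (l : ℕ) (INCR I : Finset (Fin n))
    (B : ℕ∞) : Prop :=
  ∃ f : ℕ → ℕ, ρ.IsDecomposition l P.K f ∧
    (∀ (l' : ℕ) (h : l' ∈ Finset.Icc 1 P.K), l ≤ l' → ∀ j : Fin n,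
      ρ.diff f l' j ∈ (P.interval ⟨l', h⟩ j).toSet) ∧
    (∀ l' : ℕ, l ≤ l' → l' ≤ P.K → ∀ j : Fin n, ρ.diff f l' j < 0 →
      (∃ l'' : ℕ, l ≤ l'' ∧ l'' < l' ∧ 0 < ρ.diff f l'' j) ∨ j ∈ INCR) ∧
    (∀ l' : ℕ, l - 1 ≤ l' → l' ≤ P.K → ∀ m : ℕ, m ≤ ρ.path.length →
      f (2 * l') ≤ m → (l' < P.K → m < f (2 * l' + 2)) →
      ∀ j ∈ I, j ∉ INCR → (¬ ∃ l'' : ℕ, l ≤ l'' ∧ l'' ≤ l' ∧ 0 < ρ.diff f l'' j) →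
        0 ≤ ρ.config m j ∧ ((ρ.config m j).toNat : ℕ∞) < B)

end PseudoRun

/-- The quantity `μ = (1 + K) × absMax T × scale P`. -/
def mu {n : ℕ} (T : Finset (Fin n → ℤ)) (P : GenUnbProp n) : ℕ :=
  (1 + P.K) * absMax T * P.scale

/-- The bound `g`, depending on a constant `C₁`. -/
def g {n : ℕ} (C₁ : ℕ) (T : Finset (Fin n → ℤ)) (P : GenUnbProp n) : ℕ → ℕ
  | 0 => (2 * mu T P) ^ (n ^ C₁)
  | i + 1 => (2 * mu T P * (maxDec T * g C₁ T P i)) ^ (n ^ C₁) + g C₁ T P i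

end VAS

/-!
The argument is a Rackoff-style induction on the number of components in `I`. Put
`B = maxDec T * g (|I| - 1)` and look at the first stage of the pseudo-run.

* If a constrained component reaches the value `B`, cut the loops out of the path up to that point.
  No path of length `g (|I| - 1)` can bring this component below `0` any more, so it can be dropped
  from `I` and the induction hypothesis provides the rest of the pseudo-run. For this the property
  has to hold afresh from that point on; when the point lies inside the segment whose effect is
  measured, the segment is first completed and then run once more as a whole, which is harmless
  since its effect on the constrained components is nonnegative.
* Otherwise the stage projects onto at most `B ^ n` nodes. Its first segment is made short by
  cutting out loops. Its second segment is decomposed into a short core visiting the same nodes and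
  short loops, and by Steinitz's lemma few of these loops suffice to reproduce its effect up to a
  truncation that neither the intervals of the property nor the signs can detect. The same argument
  then applies to the next stage.
-/

namespace VAS

/-! ### Subsets of small sum -/

section Steinitz

open scoped Finset

variable {ι : Type*}

theorem eq_zero_of_mem_extremePoints {V : Type*} [AddCommGroup V] [Module ℝ V] {S : Set V}
    {x b : V} (hx : x ∈ S.extremePoints ℝ) (hb : ∀ᶠ ε in nhds (0 : ℝ), x + ε • b ∈ S) : b = 0 := by
  have hb_neg : ∀ᶠ ε in nhds (0 : ℝ), x + (-ε) • b ∈ S :=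
    (continuous_neg.tendsto' 0 0 neg_zero).eventually hb
  obtain ⟨ε, ⟨hε, hε_neg⟩, hε_pos⟩ :=
    (((hb.and hb_neg).filter_mono nhdsWithin_le_nhds).and
      (self_mem_nhdsWithin : Set.Ioi (0 : ℝ) ∈ nhdsWithin 0 (Set.Ioi 0))).exists
  have hmid : x ∈ openSegment ℝ (x + ε • b) (x + (-ε) • b) :=
    ⟨1 / 2, 1 / 2, by norm_num, by norm_num, by norm_num, by module⟩
  have hεb : ε • b = 0 := by simpa using hx.2 hε hε_neg hmid
  exact (smul_eq_zero.1 hεb).resolve_left hε_pos.ne'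

theorem linearIndepOn_of_mem_extremePoints {W : Type*} [AddCommGroup W] [Module ℝ W] {w : ι → W}
    {A : Finset ι} {y : W} {x : ι → ℝ}
    (hx : x ∈ Set.extremePoints ℝ
      (Set.Icc 0 ((A : Set ι).indicator 1) ∩ {c | ∑ i ∈ A, c i • w i = y})) :
    LinearIndepOn ℝ w {i ∈ A | x i ∈ Set.Ioo 0 1} := by
  classical
  rw [← Finset.coe_filter]
  by_contra hdep
  obtain ⟨b, hb_sum, i₀, hi₀, hb_ne⟩ := not_linearIndepOn_finset_iff.1 hdep
  let b' : ι → ℝ := fun i => if i ∈ A ∧ x i ∈ Set.Ioo 0 1 then b i else 0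
  refine hb_ne ?_
  suffices b' = 0 from (if_pos (Finset.mem_filter.1 hi₀)).symm.trans (congrFun this i₀)
  have hb'_sum : ∑ i ∈ A, b' i • w i = 0 := by
    rw [← hb_sum, Finset.sum_filter]
    exact Finset.sum_congr rfl fun i hi => by simp [b', hi, ite_smul]
  obtain ⟨⟨hx0, hx1⟩, hxy⟩ := hx.1
  refine eq_zero_of_mem_extremePoints hx ?_
  have hfrac : ∀ᶠ ε in nhds (0 : ℝ), ∀ i ∈ A, x i ∈ Set.Ioo 0 1 → x i + ε * b' i ∈ Set.Ioo 0 1 := by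
    refine (Finset.eventually_all A).2 fun i _ => Filter.eventually_imp_distrib_left.2 fun hi => ?_
    have hcont : Continuous fun ε : ℝ => x i + ε * b' i := by fun_prop
    exact hcont.continuousAt.eventually_mem (isOpen_Ioo.mem_nhds (by simpa using hi))
  filter_upwards [hfrac] with ε hε
  refine ⟨Set.mem_Icc.2 (forall_and.1 fun i => ?_), ?_⟩
  · by_cases hi : i ∈ A ∧ x i ∈ Set.Ioo 0 1
    · simpa [hi.1] using Set.Ioo_subset_Icc_self (hε i hi.1 hi.2)
    · have hb'i : b' i = 0 := if_neg hi
      simpa [hb'i] using And.intro (hx0 i) (hx1 i)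
  · simpa [add_smul, Finset.sum_add_distrib, mul_smul, ← Finset.smul_sum, hb'_sum] using hxy

theorem exists_card_fractional_le_finrank {W : Type*} [AddCommGroup W] [Module ℝ W]
    [TopologicalSpace W] [ContinuousAdd W] [ContinuousSMul ℝ W] [T1Space W]
    [FiniteDimensional ℝ W] (w : ι → W) (A : Finset ι) {c : ι → ℝ}
    (hc : ∀ i ∈ A, c i ∈ Set.Icc 0 1) :
    ∃ c' : ι → ℝ, (∀ i ∈ A, c' i ∈ Set.Icc 0 1) ∧ ∑ i ∈ A, c' i • w i = ∑ i ∈ A, c i • w i ∧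
      #{i ∈ A | c' i ∈ Set.Ioo 0 1} ≤ Module.finrank ℝ W := by
  classical
  have hcompact : IsCompact (Set.Icc 0 ((A : Set ι).indicator (1 : ι → ℝ)) ∩
      {x | ∑ i ∈ A, x i • w i = ∑ i ∈ A, c i • w i}) :=
    isCompact_Icc.inter_right <| isClosed_singleton.preimage <|
      continuous_finsetSum A fun i _ => (continuous_apply i).smul continuous_const
  have hmem : (A : Set ι).indicator c ∈ Set.Icc 0 ((A : Set ι).indicator 1) := by
    refine Set.mem_Icc.2 (forall_and.1 fun i => ?_)
    by_cases hi : i ∈ A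
    · simpa [hi] using hc i hi
    · simp [hi]
  obtain ⟨c', hc'⟩ := hcompact.extremePoints_nonempty
    ⟨_, hmem, Finset.sum_congr rfl fun i hi => by simp [hi]⟩
  refine ⟨c', fun i hi => ⟨hc'.1.1.1 i, by simpa [hi] using hc'.1.1.2 i⟩, hc'.1.2, ?_⟩
  have hindep := linearIndepOn_of_mem_extremePoints hc'
  rw [← Finset.coe_filter] at hindep
  simpa using hindep.linearIndependent.fintype_card_le_finrank

variable {E : Type*} [NormedAddCommGroup E] [NormedSpace ℝ E] {v : ι → E} {A : Finset ι}

/-- The invariant of the Steinitz rearrangement argument: `A` carries coefficients in `[0, 1]` that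
cancel the vectors `v i` and whose total is at least `#A` minus the dimension. -/
def Balanced (v : ι → E) (A : Finset ι) : Prop :=
  ∃ c : ι → ℝ, (∀ i ∈ A, c i ∈ Set.Icc 0 1) ∧ ∑ i ∈ A, c i • v i = 0 ∧
    (#A : ℝ) ≤ ∑ i ∈ A, c i + Module.finrank ℝ E

theorem balanced_of_sum_eq_zero (h : ∑ i ∈ A, v i = 0) : Balanced v A :=
  ⟨1, by simp, by simpa using h, by simp⟩

theorem balanced_of_card_le_finrank (h : #A ≤ Module.finrank ℝ E) : Balanced v A :=
  ⟨0, by simp, by simp, by simpa using h⟩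

theorem Balanced.norm_sum_le (h : Balanced v A) {a : ℝ} (ha : 0 ≤ a) (hv : ∀ i ∈ A, ‖v i‖ ≤ a) :
    ‖∑ i ∈ A, v i‖ ≤ Module.finrank ℝ E * a := by
  obtain ⟨c, hc, hcv, hcard⟩ := h
  calc ‖∑ i ∈ A, v i‖ = ‖∑ i ∈ A, (1 - c i) • v i‖ := by
        simp [sub_smul, Finset.sum_sub_distrib, hcv]
    _ ≤ ∑ i ∈ A, (1 - c i) * a := norm_sum_le_of_le A fun i hi => by
        rw [norm_smul, Real.norm_of_nonneg (sub_nonneg.2 (hc i hi).2)]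
        exact mul_le_mul_of_nonneg_left (hv i hi) (sub_nonneg.2 (hc i hi).2)
    _ = (#A - ∑ i ∈ A, c i) * a := by simp [← Finset.sum_mul, Finset.sum_sub_distrib]
    _ ≤ Module.finrank ℝ E * a := by gcongr; linarith

theorem exists_eq_zero_of_card_fractional_le {c : ι → ℝ} (hc : ∀ i ∈ A, c i ∈ Set.Icc 0 1) {m : ℕ}
    (hm : 0 < m) (hfrac : #{i ∈ A | c i ∈ Set.Ioo 0 1} ≤ m) (hsum : ∑ i ∈ A, c i = #A - m) :
    ∃ i ∈ A, c i = 0 := by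
  by_contra! hne
  have hpos : ∀ i ∈ A, 0 < c i := fun i hi => (hc i hi).1.lt_of_ne' (hne i hi)
  have hdef : ∑ i ∈ A with c i ∈ Set.Ioo 0 1, (1 - c i) = (m : ℝ) := by
    rw [Finset.sum_filter_of_ne fun i hi h =>
      ⟨hpos i hi, (hc i hi).2.lt_of_ne fun h1 => h (by simp [h1])⟩]
    simp [Finset.sum_sub_distrib, hsum]
  have hnonempty : {i ∈ A | c i ∈ Set.Ioo (0 : ℝ) 1}.Nonempty := by
    refine Finset.nonempty_of_sum_ne_zero (f := fun i => 1 - c i) ?_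
    rw [hdef]
    positivity
  have hlt : ∑ i ∈ A with c i ∈ Set.Ioo 0 1, (1 - c i) < #{i ∈ A | c i ∈ Set.Ioo 0 1} := by
    simpa using Finset.sum_lt_sum_of_nonempty hnonempty (f := fun i => 1 - c i) (g := fun _ => 1)
      fun i hi => sub_lt_self 1 (Finset.mem_filter.1 hi).2.1
  rw [hdef] at hlt
  exact absurd hfrac (by exact_mod_cast not_le.2 hlt)

theorem Balanced.exists_erase [FiniteDimensional ℝ E] [DecidableEq ι] (h : Balanced v A)
    (hA : A.Nonempty) : ∃ i ∈ A, Balanced v (A.erase i) := by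
  set d := Module.finrank ℝ E
  obtain ⟨c, hc, hcv, hcard⟩ := h
  rcases le_or_gt (#A) (d + 1) with hle | hlt
  · obtain ⟨i, hi⟩ := hA
    exact ⟨i, hi, balanced_of_card_le_finrank (by rw [Finset.card_erase_of_mem hi]; omega)⟩
  have hlt' : (d : ℝ) + 1 < #A := by exact_mod_cast hlt
  set r : ℝ := (#A - (d + 1)) / ∑ i ∈ A, c i with hr
  have hr0 : 0 ≤ r := div_nonneg (by linarith) (by linarith)
  have hr1 : r ≤ 1 := div_le_one_of_le₀ (by linarith) (by linarith)
  obtain ⟨c', hc', hc'w, hfrac⟩ := exists_card_fractional_le_finrank (fun i => (v i, (1 : ℝ))) A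
    (c := fun i => r * c i)
    fun i hi => ⟨mul_nonneg hr0 (hc i hi).1, mul_le_one₀ hr1 (hc i hi).1 (hc i hi).2⟩
  have hc'v : ∑ i ∈ A, c' i • v i = 0 := by
    simpa [Prod.fst_sum, mul_smul, ← Finset.smul_sum, hcv] using congrArg Prod.fst hc'w
  have hc'_sum : ∑ i ∈ A, c' i = #A - (d + 1) := by
    have hsum : ∑ i ∈ A, c' i = r * ∑ i ∈ A, c i := by
      simpa [Prod.snd_sum, Finset.mul_sum] using congrArg Prod.snd hc'w
    rw [hsum, hr, div_mul_cancel₀ _ (by linarith)]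
  obtain ⟨i, hi, hi0⟩ := exists_eq_zero_of_card_fractional_le hc' d.succ_pos
    (by simpa using hfrac) (by push_cast; exact hc'_sum)
  refine ⟨i, hi, c', fun k hk => hc' k (Finset.mem_of_mem_erase hk), ?_, ?_⟩
  · rw [Finset.sum_erase _ (by simp [hi0]), hc'v]
  · rw [Finset.sum_erase _ hi0, hc'_sum, Finset.cast_card_erase_of_mem hi]
    linarith

theorem Balanced.exists_chain [FiniteDimensional ℝ E] (h : Balanced v A) :
    ∃ B : ℕ → Finset ι, Monotone B ∧
      ∀ k ≤ #A, B k ⊆ A ∧ #(B k) = k ∧ Balanced v (B k) := by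
  classical
  induction hm : #A generalizing A with
  | zero => exact ⟨fun _ => A, monotone_const, fun k hk => ⟨subset_rfl, by simp_all, h⟩⟩
  | succ m ih =>
    obtain ⟨i, hi, herase⟩ := h.exists_erase (Finset.card_pos.1 (by omega))
    obtain ⟨B, hmono, hB⟩ := ih herase (by rw [Finset.card_erase_of_mem hi, hm]; rfl)
    refine ⟨fun k => if k ≤ m then B k else A, fun k k' hk => ?_, fun k hk => ?_⟩
    · dsimp only
      split_ifs with h1 h2 h2
      · exact hmono hk
      · exact (hB k h1).1.trans (Finset.erase_subset _ _)
      · omega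
      · exact subset_rfl
    · dsimp only
      split_ifs with h1
      · exact ⟨(hB k h1).1.trans (Finset.erase_subset _ _), (hB k h1).2⟩
      · exact ⟨subset_rfl, by omega, h⟩

theorem exists_chain_norm_sum_le [FiniteDimensional ℝ E] {a : ℝ} (ha : 0 ≤ a)
    (hv : ∀ i ∈ A, ‖v i‖ ≤ a) (hsum : ∑ i ∈ A, v i = 0) :
    ∃ B : ℕ → Finset ι, Monotone B ∧ ∀ k ≤ #A, B k ⊆ A ∧ #(B k) = k ∧
      ‖∑ i ∈ B k, v i‖ ≤ Module.finrank ℝ E * a := by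
  obtain ⟨B, hmono, hB⟩ := (balanced_of_sum_eq_zero hsum).exists_chain
  exact ⟨B, hmono, fun k hk => ⟨(hB k hk).1, (hB k hk).2.1,
    (hB k hk).2.2.norm_sum_le ha fun i hi => hv i ((hB k hk).1 hi)⟩⟩

variable {κ : Type*} [Fintype κ] {v : ι → κ → ℤ} {s : Finset ι} {a D : ℕ}

theorem exists_chain_abs_sum_le (hv : ∀ i ∈ s, ∀ j, |v i j| ≤ a)
    (hD : ∀ j, |∑ i ∈ s, v i j| ≤ D) :
    ∃ B : ℕ → Finset ι, Monotone B ∧ ∀ k ≤ #s, B k ⊆ s ∧ #(B k) = k ∧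
      ∀ j, |∑ i ∈ B k, v i j| ≤ D + 2 * a * Fintype.card κ := by
  let mean : κ → ℝ := fun j => (∑ i ∈ s, (v i j : ℝ)) / #s
  have hcard_mean : ∀ j, #s * mean j = ∑ i ∈ s, (v i j : ℝ) := fun j => by
    rcases s.eq_empty_or_nonempty with rfl | hs
    · simp
    · exact mul_div_cancel₀ _ (by exact_mod_cast hs.card_ne_zero)
  have hv' : ∀ i ∈ s, ∀ j, |(v i j : ℝ)| ≤ a := fun i hi j => by exact_mod_cast hv i hi j
  have hD' : ∀ j, |∑ i ∈ s, (v i j : ℝ)| ≤ D := fun j => by exact_mod_cast hD j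
  have hmean : ∀ j, |mean j| ≤ a := fun j => by
    rw [abs_div, Nat.abs_cast]
    refine div_le_of_le_mul₀ (by positivity) (by positivity) ?_
    calc |∑ i ∈ s, (v i j : ℝ)| ≤ ∑ i ∈ s, |(v i j : ℝ)| := Finset.abs_sum_le_sum_abs _ _
      _ ≤ #s • (a : ℝ) := Finset.sum_le_card_nsmul _ _ _ fun i hi => hv' i hi j
      _ = a * #s := by rw [nsmul_eq_mul, mul_comm]
  obtain ⟨B, hmono, hB⟩ := exists_chain_norm_sum_le (A := s) (a := 2 * a)
    (v := fun i j => (v i j : ℝ) - mean j) (by positivity)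
    (fun i hi => (pi_norm_le_iff_of_nonneg (by positivity)).2 fun j =>
      (abs_sub _ _).trans (by linarith [hv' i hi j, hmean j]))
    (funext fun j => by simp [Finset.sum_sub_distrib, hcard_mean])
  refine ⟨B, hmono, fun k hk => ⟨(hB k hk).1, (hB k hk).2.1, fun j => ?_⟩⟩
  have hdev : |∑ i ∈ B k, ((v i j : ℝ) - mean j)| ≤ 2 * a * Fintype.card κ := by
    have hcoord := (norm_le_pi_norm _ j).trans (hB k hk).2.2
    rw [Finset.sum_apply, Real.norm_eq_abs, Module.finrank_fintype_fun_eq_card] at hcoord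
    linarith
  have hdrift : |k * mean j| ≤ D := by
    rw [abs_mul, Nat.abs_cast]
    calc k * |mean j| ≤ #s * |mean j| := by gcongr
      _ = |∑ i ∈ s, (v i j : ℝ)| := by rw [← hcard_mean, abs_mul, Nat.abs_cast]
      _ ≤ D := hD' j
  have hsum : |∑ i ∈ B k, (v i j : ℝ)| ≤ D + 2 * a * Fintype.card κ := by
    calc |∑ i ∈ B k, (v i j : ℝ)| = |k * mean j + ∑ i ∈ B k, ((v i j : ℝ) - mean j)| := by
          simp [Finset.sum_sub_distrib, (hB k hk).2.1]
      _ ≤ D + 2 * a * Fintype.card κ := (abs_add_le _ _).trans (add_le_add hdrift hdev)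
  exact_mod_cast hsum

theorem exists_zero_sum_subset (hv : ∀ i ∈ s, ∀ j, |v i j| ≤ a) (hD : ∀ j, |∑ i ∈ s, v i j| ≤ D)
    (hs : (2 * (D + 2 * a * Fintype.card κ) + 1) ^ Fintype.card κ ≤ #s) :
    ∃ t ⊆ s, t.Nonempty ∧ ∀ j, ∑ i ∈ t, v i j = 0 := by
  classical
  obtain ⟨B, hmono, hB⟩ := exists_chain_abs_sum_le hv hD
  set R : ℕ := D + 2 * a * Fintype.card κ with hR
  let box : Finset (κ → ℤ) := Fintype.piFinset fun _ => Finset.Icc (-(R : ℤ)) R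
  have hbox : #box < #(Finset.range (#s + 1)) := by
    have hcard : (R + 1 + R : ℤ).toNat = 2 * R + 1 := by omega
    simpa [box, hcard] using Nat.lt_succ_of_le hs
  obtain ⟨k, hk, k', hk', hne, heq⟩ := Finset.exists_ne_map_eq_of_card_lt_of_maps_to hbox
    (f := fun k j => ∑ i ∈ B k, v i j) fun k hk => Fintype.mem_piFinset.2 fun j => by
      have hk' : k ≤ #s := Finset.mem_range_succ_iff.1 hk
      exact Finset.mem_Icc.2 (abs_le.1 (by simpa [hR] using (hB k hk').2.2 j))
  wlog hlt : k < k' generalizing k k'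
  · exact this k' hk' k hk hne.symm heq.symm (by omega)
  rw [Finset.mem_range_succ_iff] at hk hk'
  refine ⟨B k' \ B k, Finset.sdiff_subset.trans (hB k' hk').1, ?_, fun j => ?_⟩
  · refine Finset.card_pos.1 ?_
    rw [Finset.card_sdiff_of_subset (hmono hlt.le), (hB k hk).2.1, (hB k' hk').2.1]
    omega
  · rw [Finset.sum_sdiff_eq_sub (hmono hlt.le), sub_eq_zero]
    exact (congrFun heq j).symm

theorem exists_small_subset_sum_eq (hv : ∀ i ∈ s, ∀ j, |v i j| ≤ a)
    (hD : ∀ j, |∑ i ∈ s, v i j| ≤ D) :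
    ∃ t ⊆ s, #t ≤ (2 * (D + 2 * a * Fintype.card κ) + 1) ^ Fintype.card κ ∧
      ∀ j, ∑ i ∈ t, v i j = ∑ i ∈ s, v i j := by
  classical
  induction s using Finset.strongInduction with
  | H s ih =>
    rcases le_total (#s) ((2 * (D + 2 * a * Fintype.card κ) + 1) ^ Fintype.card κ) with h | h
    · exact ⟨s, subset_rfl, h, fun _ => rfl⟩
    obtain ⟨z, hzs, hz, hz0⟩ := exists_zero_sum_subset hv hD h
    have hsum : ∀ j, ∑ i ∈ s \ z, v i j = ∑ i ∈ s, v i j := fun j => by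
      rw [Finset.sum_sdiff_eq_sub hzs, hz0 j, sub_zero]
    obtain ⟨t, hts, hcard, ht⟩ := ih (s \ z) (Finset.sdiff_ssubset hzs hz)
      (fun i hi => hv i (Finset.sdiff_subset hi)) fun j => by rw [hsum]; exact hD j
    exact ⟨t, hts.trans Finset.sdiff_subset, hcard, fun j => (ht j).trans (hsum j)⟩

theorem exists_sum_sign_eq {β : Type*} [Finite β] (e : β → ℤ) :
    ∃ (m : ℕ) (w : Fin m → β → ℤ), (∀ i j, w i j = 0 ∨ w i j = (e j).sign) ∧
      ∀ j, ∑ i, w i j = e j := by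
  classical
  have := Fintype.ofFinite β
  let w : (Σ j, Fin (e j).natAbs) → β → ℤ := fun x => Pi.single x.1 (e x.1).sign
  have hw : ∀ x j, w x j = 0 ∨ w x j = (e j).sign := fun x j => by
    by_cases h : x.1 = j
    · exact .inr (by subst h; simp [w])
    · exact .inl (by simp [w, Ne.symm h])
  refine ⟨_, fun i => w ((Fintype.equivFin _).symm i), fun i => hw _, fun j => ?_⟩
  rw [Equiv.sum_comp (Fintype.equivFin _).symm fun x => w x j]
  simpa [w, Fintype.sum_sigma, Pi.single_apply, mul_comm] using (e j).sign_mul_abs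

theorem exists_small_subset_sum_same_side (ha : 1 ≤ a) (hv : ∀ i ∈ s, ∀ j, |v i j| ≤ a)
    {c : κ → ℤ} (hc : ∀ j, |c j| ≤ D) :
    ∃ t ⊆ s, #t ≤ (2 * (D + 2 * a * Fintype.card κ) + 1) ^ Fintype.card κ ∧
      ∀ j, (c j ≤ ∑ i ∈ s, v i j → c j ≤ ∑ i ∈ t, v i j) ∧
        (∑ i ∈ s, v i j ≤ c j → ∑ i ∈ t, v i j ≤ c j) := by
  classical
  -- Pad `v` with signed unit vectors so that the total becomes `c`. Within one component the
  -- padding has constant sign, so dropping it from the selection leaves a sum on the right side.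
  obtain ⟨m, w, hw, hw_sum⟩ := exists_sum_sign_eq fun j => c j - ∑ i ∈ s, v i j
  have hpad : ∀ x ∈ s.disjSum Finset.univ, ∀ j, |Sum.elim v w x j| ≤ a := by
    rintro (i | i) hx j
    · exact hv i (by simpa using hx) j
    · have hw_abs : |w i j| ≤ 1 := by
        rcases hw i j with h | h
        · simp [h]
        · rw [h]
          rcases Int.sign_trichotomy (c j - ∑ i ∈ s, v i j) with h | h | h <;> simp [h]
      exact hw_abs.trans (by exact_mod_cast ha)
  have hsum : ∀ j, ∑ x ∈ s.disjSum Finset.univ, Sum.elim v w x j = c j := fun j => by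
    simp [Finset.sum_disjSum, hw_sum]
  obtain ⟨t, hts, hcard, ht⟩ :=
    exists_small_subset_sum_eq hpad fun j => (congrArg abs (hsum j)).trans_le (hc j)
  refine ⟨t.toLeft, fun i hi => ?_, Finset.card_toLeft_le.trans hcard, fun j => ?_⟩
  · simpa using hts (Finset.mem_toLeft.1 hi)
  have hsplit : ∑ i ∈ t.toLeft, v i j + ∑ i ∈ t.toRight, w i j = c j := by
    rw [← hsum j, ← ht j, ← t.toLeft_disjSum_toRight]
    simp [Finset.sum_disjSum]
  refine ⟨fun h => ?_, fun h => ?_⟩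
  · have : ∑ i ∈ t.toRight, w i j ≤ 0 := Finset.sum_nonpos fun i _ =>
      (hw i j).elim le_of_eq fun hi => hi.trans_le (Int.sign_nonpos_iff.2 (sub_nonpos.2 h))
    linarith
  · have : 0 ≤ ∑ i ∈ t.toRight, w i j := Finset.sum_nonneg fun i _ =>
      (hw i j).elim ge_of_eq fun hi => hi ▸ Int.sign_nonneg_iff.2 (sub_nonneg.2 h)
    linarith

/-- `d` and `d'` agree once all the integers above `σ`, and all those below `-σ`, are identified.
Intervals whose finite endpoints have absolute value at most `σ` do not separate such integers. -/
def TruncEq (σ : ℕ) (d d' : ℤ) : Prop :=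
  d = d' ∨ ((σ : ℤ) < d ∧ (σ : ℤ) < d') ∨ (d < -σ ∧ d' < -σ)

namespace TruncEq

variable {σ : ℕ} {d d' : ℤ}

theorem mem_toSet_iff (h : TruncEq σ d d') {E : IntervalExpr} (hE : E.maxAbs ≤ σ) :
    d ∈ E.toSet ↔ d' ∈ E.toSet := by
  unfold TruncEq at h
  cases E <;> simp only [IntervalExpr.toSet, IntervalExpr.maxAbs, Set.mem_univ, Set.mem_Ici,
    Set.mem_Iic, Set.mem_Icc] at hE ⊢ <;> omega

theorem pos_iff (h : TruncEq σ d d') : 0 < d ↔ 0 < d' := by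
  unfold TruncEq at h
  omega

theorem nonneg_iff (h : TruncEq σ d d') : 0 ≤ d ↔ 0 ≤ d' := by
  unfold TruncEq at h
  omega

end TruncEq

theorem exists_small_subset_truncEq {σ ζ : ℕ} (ha : 1 ≤ a) (hv : ∀ i ∈ s, ∀ j, |v i j| ≤ a)
    {z : κ → ℤ} (hz : ∀ j, |z j| ≤ ζ) :
    ∃ t ⊆ s, #t ≤ (2 * (σ + 1 + ζ + 2 * a * Fintype.card κ) + 1) ^ Fintype.card κ ∧
      ∀ j, TruncEq σ (z j + ∑ i ∈ s, v i j) (z j + ∑ i ∈ t, v i j) := by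
  let target : κ → ℤ := fun j => max (-(σ + 1 : ℤ)) (min (σ + 1) (z j + ∑ i ∈ s, v i j)) - z j
  have htarget : ∀ j, |target j| ≤ (σ + 1 + ζ : ℕ) := fun j => by
    have := abs_le.1 (hz j)
    simp only [target, abs_le]
    omega
  obtain ⟨t, hts, hcard, ht⟩ := exists_small_subset_sum_same_side ha hv htarget
  refine ⟨t, hts, hcard, fun j => ?_⟩
  have := ht j
  simp only [target] at this
  unfold TruncEq
  omega

theorem exists_short_list_truncEq {α : Type*} {f : α → κ → ℤ} {l : List α} {σ ζ : ℕ} (ha : 1 ≤ a)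
    (hf : ∀ x ∈ l, ∀ j, |f x j| ≤ a) {z : κ → ℤ} (hz : ∀ j, |z j| ≤ ζ) :
    ∃ l' ⊆ l,
      l'.length ≤ (2 * (σ + 1 + ζ + 2 * a * Fintype.card κ) + 1) ^ Fintype.card κ ∧
      ∀ j, TruncEq σ ((z + (l.map f).sum) j) ((z + (l'.map f).sum) j) := by
  obtain ⟨t, -, hcard, ht⟩ := exists_small_subset_truncEq (s := Finset.univ)
    (v := fun i => f (l[i])) (σ := σ) ha (fun i _ => hf _ (l.get_mem i)) hz
  refine ⟨t.toList.map (l[·]), fun x hx => ?_, by simpa using hcard, fun j => ?_⟩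
  · obtain ⟨i, -, rfl⟩ := List.mem_map.1 hx
    exact l.get_mem i
  · have hl : ∑ i : Fin l.length, f l[i] = (l.map f).sum := Fin.sum_univ_fun_getElem l f
    have ht' : ∑ i ∈ t, f l[i] = ((t.toList.map (l[·])).map f).sum := by
      rw [List.map_map, ← Finset.sum_map_toList]
      rfl
    rw [← hl, ← ht']
    simpa only [Pi.add_apply, Finset.sum_apply] using ht j

end Steinitz

/-! ### Loops of walks in a quotient -/

section Walks

open scoped Finset

variable {G H : Type*} [AddCommGroup G] [AddCommGroup H] [DecidableEq H] {π : G →+ H} {y : H}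

/-- The nodes from which the steps of the walk `p` start, seen in the quotient `H` and for a walk
that starts over `y : H`. The final node is left out, as in the half-open ranges of positions over
which `PseudoRun.SatisfiesApprox` constrains the configurations. -/
def visited (π : G →+ H) (y : H) (p : List G) : Finset H :=
  (Finset.range p.length).image fun m => y + π (p.take m).sum

theorem mem_visited {p : List G} {z : H} :
    z ∈ visited π y p ↔ ∃ m < p.length, y + π (p.take m).sum = z := by
  simp [visited]

theorem visited_nil : visited π y [] = ∅ := rfl

theorem visited_append (p q : List G) :
    visited π y (p ++ q) = visited π y p ∪ visited π (y + π p.sum) q := by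
  ext z
  simp only [Finset.mem_union, mem_visited, List.length_append]
  constructor
  · rintro ⟨m, hm, rfl⟩
    rcases lt_or_ge m p.length with h | h
    · exact .inl ⟨m, h, by rw [List.take_append_of_le_length h.le]⟩
    · refine .inr ⟨m - p.length, by omega, ?_⟩
      rw [List.take_append, List.take_of_length_le h, List.sum_append, map_add, add_assoc]
  · rintro (⟨m, hm, rfl⟩ | ⟨m, hm, rfl⟩)
    · exact ⟨m, by omega, by rw [List.take_append_of_le_length hm.le]⟩
    · refine ⟨p.length + m, by omega, ?_⟩
      rw [List.take_length_add_append, List.sum_append, map_add, add_assoc]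

theorem mem_visited_iff_exists_append {p : List G} {z : H} :
    z ∈ visited π y p ↔ ∃ a b, p = a ++ b ∧ b ≠ [] ∧ y + π a.sum = z := by
  refine mem_visited.trans ⟨?_, ?_⟩
  · rintro ⟨m, hm, hz⟩
    exact ⟨_, _, (p.take_append_drop m).symm, by simpa using hm, hz⟩
  · rintro ⟨a, b, rfl, hb, hz⟩
    exact ⟨a.length, by simpa using List.length_pos_iff.2 hb, by simpa using hz⟩

theorem visited_append_loop {b : List G} (hb : π b.sum = 0) (a c : List G) :
    visited π y (a ++ b ++ c) = visited π y (a ++ c) ∪ visited π (y + π a.sum) b := by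
  simp only [visited_append, List.sum_append, map_add, hb, add_zero, Finset.union_right_comm]

theorem exists_loop_of_card_visited_lt {p : List G} (hp : #(visited π y p) < p.length) :
    ∃ a b c, p = a ++ b ++ c ∧ b ≠ [] ∧ c ≠ [] ∧ π b.sum = 0 := by
  obtain ⟨m, hm, m', hm', hne, heq⟩ := Finset.exists_ne_map_eq_of_card_lt_of_maps_to
    (s := Finset.range p.length) (by simpa [visited] using hp)
    fun m hm => Finset.mem_image_of_mem _ hm
  wlog hlt : m < m' generalizing m m'
  · exact this m' hm' m hm hne.symm heq.symm (by omega)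
  have hm' := Finset.mem_range.1 hm'
  have hsplit : p.take m' = p.take m ++ (p.take m').drop m := by
    conv_lhs => rw [← List.take_append_drop m (p.take m'), List.take_take, min_eq_left hlt.le]
  refine ⟨p.take m, (p.take m').drop m, p.drop m', ?_, ?_, ?_, ?_⟩
  · rw [← hsplit, List.take_append_drop]
  · exact List.ne_nil_of_length_pos (by simp only [List.length_drop, List.length_take]; omega)
  · exact List.ne_nil_of_length_pos (by rw [List.length_drop]; omega)
  · rw [hsplit, List.sum_append, map_add, ← add_assoc] at heq
    simpa using heq

theorem exists_short_walk (π : G →+ H) (y : H) (p : List G) :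
    ∃ p' : List G, p'.Sublist p ∧ visited π y p' ⊆ visited π y p ∧ π p'.sum = π p.sum ∧
      p'.length ≤ #(visited π y p) := by
  induction hk : p.length using Nat.strong_induction_on generalizing p with
  | _ k ih =>
    rcases le_or_gt p.length #(visited π y p) with hle | hlt
    · exact ⟨p, .refl p, subset_rfl, rfl, hle⟩
    obtain ⟨a, b, c, rfl, hb, -, hb0⟩ := exists_loop_of_card_visited_lt hlt
    have hshort : (a ++ c).length < k := by
      simpa [← hk] using List.length_pos_iff.2 hb
    obtain ⟨p', hsub, hvis, hsum, hlen⟩ := ih _ hshort (a ++ c) rfl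
    have hac : visited π y (a ++ c) ⊆ visited π y (a ++ b ++ c) := by
      rw [visited_append_loop hb0]
      exact Finset.subset_union_left
    exact ⟨p', hsub.trans ((List.sublist_append_left a b).append_right c), hvis.trans hac,
      by simp [hsum, hb0], hlen.trans (Finset.card_le_card hac)⟩

theorem exists_loop_in_visited {N : ℕ} {q : List G} (hN : #(visited π y q) ≤ N)
    (hq : (N + 1) * #(visited π y q) < q.length) :
    ∃ a b c, q = a ++ b ++ c ∧ b ≠ [] ∧ b.length ≤ N ∧ π b.sum = 0 ∧
      visited π (y + π a.sum) b ⊆ visited π y a := by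
  induction hk : #(visited π y q) using Nat.strong_induction_on generalizing q with
  | _ k ih =>
    have hk_pos : 0 < k := by
      rw [← hk, Finset.card_pos]
      exact ⟨y, mem_visited.2 ⟨0, by omega, by simp⟩⟩
    have hlen : N + 1 ≤ q.length := by nlinarith
    obtain ⟨q', w, rfl, hw⟩ : ∃ q' w, q = q' ++ w ∧ w.length = N + 1 :=
      ⟨_, _, (q.take_append_drop (q.length - (N + 1))).symm, by rw [List.length_drop]; omega⟩
    have hvis := visited_append (π := π) (y := y) q' w
    by_cases hsub : visited π (y + π q'.sum) w ⊆ visited π y q'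
    · have hcard : #(visited π (y + π q'.sum) w) < w.length := by
        rw [hw, Nat.lt_succ_iff]
        exact (Finset.card_le_card (hvis ▸ Finset.subset_union_right)).trans hN
      obtain ⟨a, b, c, rfl, hb, hc, hb0⟩ := exists_loop_of_card_visited_lt hcard
      have := List.length_pos_iff.2 hc
      have hb_len : b.length ≤ N := by
        rw [List.length_append, List.length_append] at hw
        omega
      refine ⟨q' ++ a, b, c, by simp, hb, hb_len, hb0, ?_⟩
      rw [visited_append, List.sum_append, map_add, ← add_assoc]
      refine Finset.Subset.trans ?_ (hsub.trans Finset.subset_union_left)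
      rw [visited_append_loop hb0]
      exact Finset.subset_union_right
    · have hlt : #(visited π y q') < k := by
        rw [← hk, hvis]
        exact Finset.card_lt_card (left_lt_sup.2 hsub)
      have hq' : (N + 1) * #(visited π y q') < q'.length := by
        rw [List.length_append, hw] at hq
        nlinarith
      obtain ⟨a, b, c, rfl, h⟩ := ih _ hlt (by omega) hq' rfl
      exact ⟨a, b, c ++ w, by simp, h⟩

/-- `w` is a loop of the quotient all of whose nodes, for a suitable base point, lie in `V`. -/
def IsLoopIn (π : G →+ H) (V : Finset H) (w : List G) : Prop :=
  π w.sum = 0 ∧ w ≠ [] ∧ ∃ y, visited π y w ⊆ V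

theorem map_sum_flatten_eq_zero {V : Finset H} {ls : List (List G)}
    (hls : ∀ w ∈ ls, IsLoopIn π V w) : π ls.flatten.sum = 0 := by
  rw [List.sum_flatten, map_list_sum, List.map_map]
  exact List.sum_eq_zero fun x hx => by
    obtain ⟨w, hw, rfl⟩ := List.mem_map.1 hx
    exact (hls w hw).1

theorem exists_core_loops (π : G →+ H) (y : H) (q : List G) :
    ∃ (c : List G) (ls : List (List G)), q.Perm (c ++ ls.flatten) ∧
      visited π y c = visited π y q ∧ c.length ≤ (#(visited π y q) + 1) * #(visited π y q) ∧
      ∀ w ∈ ls, IsLoopIn π (visited π y q) w ∧ w.length ≤ #(visited π y q) := by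
  induction hk : q.length using Nat.strong_induction_on generalizing q with
  | _ k ih =>
    rcases le_or_gt q.length ((#(visited π y q) + 1) * #(visited π y q)) with hle | hlt
    · exact ⟨q, [], by simp, rfl, hle, by simp⟩
    obtain ⟨a, b, d, rfl, hb, hb_len, hb0, hb_vis⟩ := exists_loop_in_visited le_rfl hlt
    have hvis : visited π y (a ++ b ++ d) = visited π y (a ++ d) := by
      rw [visited_append_loop hb0, visited_append, Finset.union_eq_left]
      exact hb_vis.trans Finset.subset_union_left
    rw [hvis] at hb_len ⊢
    have hshort : (a ++ d).length < k := by
      simpa [← hk] using List.length_pos_iff.2 hb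
    obtain ⟨c, ls, hperm, hc_vis, hc_len, hls⟩ := ih _ hshort (a ++ d) rfl
    have hloop : IsLoopIn π (visited π y (a ++ d)) b :=
      ⟨hb0, hb, _, hb_vis.trans (visited_append (π := π) a d ▸ Finset.subset_union_left)⟩
    refine ⟨c, b :: ls, ?_, hc_vis, hc_len, List.forall_mem_cons.2 ⟨⟨hloop, hb_len⟩, hls⟩⟩
    simp only [← Multiset.coe_eq_coe, List.flatten_cons, ← Multiset.coe_add] at hperm ⊢
    rw [add_right_comm, hperm, add_assoc, add_comm (ls.flatten : Multiset G)]

theorem exists_insert_loops (c : List G) (ls : List (List G))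
    (hls : ∀ w ∈ ls, IsLoopIn π (visited π y c) w) :
    ∃ c', c'.Perm (c ++ ls.flatten) ∧ visited π y c' = visited π y c := by
  induction ls with
  | nil => exact ⟨c, by simp, rfl⟩
  | cons w ls ih =>
    obtain ⟨⟨hw0, hw, z, hz⟩, hls⟩ := List.forall_mem_cons.1 hls
    obtain ⟨c', hperm, hvis⟩ := ih hls
    have hz_mem : z ∈ visited π y c' :=
      hvis ▸ hz (mem_visited.2 ⟨0, List.length_pos_iff.2 hw, by simp⟩)
    obtain ⟨a, b, rfl, -, rfl⟩ := mem_visited_iff_exists_append.1 hz_mem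
    refine ⟨a ++ w ++ b, ?_, ?_⟩
    · simp only [← Multiset.coe_eq_coe, List.flatten_cons, ← Multiset.coe_add] at hperm ⊢
      rw [add_right_comm, hperm, add_assoc, add_comm (ls.flatten : Multiset G)]
    · rw [visited_append_loop hw0, hvis, Finset.union_eq_left]
      exact hz

end Walks

/-! ### Shortening segments -/

section Segments

variable {n : ℕ} {T : Finset (Fin n → ℤ)} {J : Finset (Fin n)} {X : Set ℤ} {u u' : Fin n → ℤ}
  {p q : List (Fin n → ℤ)} {B : ℕ}

theorem abs_apply_le_absMax {t : Fin n → ℤ} (ht : t ∈ T) (j : Fin n) : |t j| ≤ absMax T := by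
  rw [Int.abs_eq_natAbs]
  exact_mod_cast (Finset.le_sup (f := fun i => (t i).natAbs) (Finset.mem_univ j)).trans
    (Finset.le_sup (f := fun b : Fin n → ℤ => Finset.univ.sup fun i => (b i).natAbs) ht)

theorem neg_maxDec_le_apply {t : Fin n → ℤ} (ht : t ∈ T) (j : Fin n) : -(maxDec T : ℤ) ≤ t j := by
  have h : (-(t j)).toNat ≤ maxDec T :=
    (Finset.le_sup (f := fun i => (-(t i)).toNat) (Finset.mem_univ j)).trans
      (Finset.le_sup (f := fun b : Fin n → ℤ => Finset.univ.sup fun i => (-(b i)).toNat) ht)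
  omega

theorem maxDec_le_absMax (T : Finset (Fin n → ℤ)) : maxDec T ≤ absMax T :=
  Finset.sup_mono_fun fun _ _ => Finset.sup_mono_fun fun _ _ => by omega

theorem abs_sum_apply_le (hp : ∀ t ∈ p, t ∈ T) (j : Fin n) :
    |p.sum j| ≤ (absMax T * p.length : ℕ) := by
  induction p with
  | nil => simp
  | cons t p ih =>
    obtain ⟨ht, hp⟩ := List.forall_mem_cons.1 hp
    calc |(t :: p).sum j| ≤ |t j| + |p.sum j| := by simpa using abs_add_le (t j) (p.sum j)
      _ ≤ absMax T + (absMax T * p.length : ℕ) := add_le_add (abs_apply_le_absMax ht j) (ih hp)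
      _ = (absMax T * (t :: p).length : ℕ) := by push_cast [List.length_cons]; ring

theorem neg_maxDec_mul_length_le_sum_apply (hp : ∀ t ∈ p, t ∈ T) (j : Fin n) :
    -(maxDec T * p.length : ℤ) ≤ p.sum j := by
  induction p with
  | nil => simp
  | cons t p ih =>
    obtain ⟨ht, hp⟩ := List.forall_mem_cons.1 hp
    calc -(maxDec T * (t :: p).length : ℤ) = -maxDec T + -(maxDec T * p.length) := by
          push_cast [List.length_cons]; ring
      _ ≤ (t :: p).sum j := by simpa using add_le_add (neg_maxDec_le_apply ht j) (ih hp)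

/-- The projection of `ℤⁿ` onto the components in `J`. -/
def coords (J : Finset (Fin n)) : (Fin n → ℤ) →+ (J → ℤ) :=
  (LinearMap.funLeft ℤ ℤ (Subtype.val : J → Fin n)).toAddMonoidHom

theorem coords_eq_iff : coords J u = coords J u' ↔ ∀ j ∈ J, u j = u' j := by
  simp [coords, funext_iff, LinearMap.funLeft]

/-- Along the path `p` from `u`, the components in `J` of all configurations but the last one lie
in `X`. -/
def StaysIn (J : Finset (Fin n)) (X : Set ℤ) (u : Fin n → ℤ) (p : List (Fin n → ℤ)) : Prop :=
  ∀ z ∈ visited (coords J) (coords J u) p, ∀ j, z j ∈ X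

theorem staysIn_iff_forall_take :
    StaysIn J X u p ↔ ∀ m < p.length, ∀ j ∈ J, (u + (p.take m).sum) j ∈ X := by
  simp only [StaysIn, mem_visited, forall_exists_index, and_imp, forall_apply_eq_imp_iff₂,
    ← map_add]
  simp [coords, LinearMap.funLeft]

theorem staysIn_append :
    StaysIn J X u (p ++ q) ↔ StaysIn J X u p ∧ StaysIn J X (u + p.sum) q := by
  simp only [StaysIn, visited_append, Finset.forall_mem_union, map_add]

theorem staysIn_nil : StaysIn J X u [] := by
  simp [StaysIn, visited_nil]

theorem staysIn_singleton {t : Fin n → ℤ} : StaysIn J X u [t] ↔ ∀ j ∈ J, u j ∈ X := by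
  simp [staysIn_iff_forall_take]

theorem StaysIn.mono {J' : Finset (Fin n)} (h : StaysIn J (Set.Ici 0) u p) (hJ : J' ⊆ J)
    (hu : ∀ j ∈ J', u j ≤ u' j) : StaysIn J' (Set.Ici 0) u' p :=
  staysIn_iff_forall_take.2 fun m hm j hj =>
    (staysIn_iff_forall_take.1 h m hm j (hJ hj)).trans (add_le_add_left (hu j hj) _)

theorem StaysIn.congr (h : StaysIn J X u p) (hu : ∀ j ∈ J, u j = u' j) : StaysIn J X u' p := by
  unfold StaysIn at h ⊢
  rwa [← coords_eq_iff.2 hu]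

theorem StaysIn.of_Ico (h : StaysIn J (Set.Ico 0 B) u p) : StaysIn J (Set.Ici 0) u p :=
  fun z hz j => (h z hz j).1

theorem StaysIn.bounded_or_exits (h : StaysIn J (Set.Ici 0) u p) (B : ℕ) :
    StaysIn J (Set.Ico 0 B) u p ∨
      ∃ a b, p = a ++ b ∧ StaysIn J (Set.Ico 0 B) u a ∧ ∃ j ∈ J, B ≤ (u + a.sum) j := by
  induction p using List.reverseRecOn with
  | nil => exact .inl staysIn_nil
  | append_singleton p t ih =>
    obtain ⟨hp, ht⟩ := staysIn_append.1 h
    rcases ih hp with hB | ⟨a, b, rfl, ha⟩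
    · by_cases hexit : ∃ j ∈ J, B ≤ (u + p.sum) j
      · exact .inr ⟨p, [t], rfl, hB, hexit⟩
      · push Not at hexit
        exact .inl (staysIn_append.2 ⟨hB, staysIn_singleton.2 fun j hj =>
          ⟨staysIn_singleton.1 ht j hj, hexit j hj⟩⟩)
    · exact .inr ⟨a, b ++ [t], by simp, ha⟩

theorem StaysIn.card_visited_le (h : StaysIn J (Set.Ico 0 B) u p) (hB : 1 ≤ B) :
    (visited (coords J) (coords J u) p).card ≤ B ^ n := by
  calc (visited (coords J) (coords J u) p).card
      ≤ (Fintype.piFinset fun _ : J => Finset.Ico (0 : ℤ) B).card :=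
        Finset.card_le_card fun z hz => Fintype.mem_piFinset.2 fun j => Finset.mem_Ico.2 (h z hz j)
    _ = B ^ J.card := by simp
    _ ≤ B ^ n := Nat.pow_le_pow_right hB (card_finset_fin_le J)

theorem StaysIn.exists_short_walk (h : StaysIn J (Set.Ico 0 B) u p) (hB : 1 ≤ B) :
    ∃ p' : List (Fin n → ℤ), p'.Sublist p ∧ StaysIn J (Set.Ico 0 B) u p' ∧
      (∀ j ∈ J, p'.sum j = p.sum j) ∧ p'.length ≤ B ^ n := by
  obtain ⟨p', hsub, hvis, hsum, hlen⟩ := VAS.exists_short_walk (coords J) (coords J u) p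
  exact ⟨p', hsub, fun z hz => h z (hvis hz), coords_eq_iff.1 hsum,
    hlen.trans (h.card_visited_le hB)⟩

/-- A bound on the length of a segment that projects onto at most `M` nodes, has transitions with
entries bounded by `τ`, and must realize an effect of `ℤⁿ` up to `TruncEq σ`: the first summand
bounds the core of the segment and the second one its at most
`(2 * (σ + 1 + τ * ((M + 1) * M) + 2 * (τ * M) * n) + 1) ^ n` additional loops. -/
def segmentBound (n τ σ M : ℕ) : ℕ :=
  (M + 1) * M + (2 * (σ + 1 + τ * ((M + 1) * M) + 2 * (τ * M) * n) + 1) ^ n * M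

theorem exists_few_lists_truncEq {c : List (Fin n → ℤ)} {ls : List (List (Fin n → ℤ))} {M R : ℕ}
    (hT : 1 ≤ absMax T) (hM : 1 ≤ M) (hc : ∀ t ∈ c, t ∈ T) (hc_len : c.length ≤ R)
    (hls : ∀ w ∈ ls, ∀ t ∈ w, t ∈ T) (hls_len : ∀ w ∈ ls, w.length ≤ M) (σ : ℕ) :
    ∃ ls' ⊆ ls, ls'.length ≤ (2 * (σ + 1 + absMax T * R + 2 * (absMax T * M) * n) + 1) ^ n ∧
      ∀ j, TruncEq σ ((c ++ ls.flatten).sum j) ((c ++ ls'.flatten).sum j) := by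
  obtain ⟨ls', hls', hlen, htrunc⟩ := exists_short_list_truncEq (l := ls) (f := List.sum) (σ := σ)
    (z := c.sum) (a := absMax T * M) (ζ := absMax T * R) (Nat.mul_pos hT hM)
    (fun w hw j => (abs_sum_apply_le (hls w hw) j).trans
      (by exact_mod_cast Nat.mul_le_mul_left _ (hls_len w hw)))
    (fun j => (abs_sum_apply_le hc j).trans (by exact_mod_cast Nat.mul_le_mul_left _ hc_len))
  exact ⟨ls', hls', by simpa using hlen, by simpa [List.sum_flatten] using htrunc⟩

theorem StaysIn.exists_short_segment (h : StaysIn J (Set.Ico 0 B) u q) (hB : 1 ≤ B)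
    (hT : 1 ≤ absMax T) (hq : ∀ t ∈ q, t ∈ T) (σ : ℕ) :
    ∃ q', (∀ t ∈ q', t ∈ T) ∧ StaysIn J (Set.Ico 0 B) u q' ∧ (∀ j ∈ J, q'.sum j = q.sum j) ∧
      (∀ j, TruncEq σ (q.sum j) (q'.sum j)) ∧ q'.length ≤ segmentBound n (absMax T) σ (B ^ n) := by
  have hM : (visited (coords J) (coords J u) q).card ≤ B ^ n := h.card_visited_le hB
  obtain ⟨c, ls, hq_perm, hc_vis, hc_len, hls⟩ := exists_core_loops (coords J) (coords J u) q
  have hcT : ∀ t ∈ c, t ∈ T := fun t ht => hq t (hq_perm.mem_iff.2 (List.mem_append_left _ ht))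
  have hlsT : ∀ w ∈ ls, ∀ t ∈ w, t ∈ T := fun w hw t ht =>
    hq t (hq_perm.mem_iff.2 (List.mem_append_right _ (List.mem_flatten_of_mem hw ht)))
  have hc_len : c.length ≤ (B ^ n + 1) * B ^ n := hc_len.trans (by gcongr)
  have hls_len : ∀ w ∈ ls, w.length ≤ B ^ n := fun w hw => (hls w hw).2.trans hM
  obtain ⟨ls', hls', hls'_len, htrunc⟩ :=
    exists_few_lists_truncEq hT (Nat.pow_pos hB) hcT hc_len hlsT hls_len σ
  obtain ⟨q', hq'_perm, hq'_vis⟩ :=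
    exists_insert_loops c ls' fun w hw => hc_vis ▸ (hls w (hls' hw)).1
  refine ⟨q', fun t ht => ?_, fun z hz => h z (hc_vis ▸ hq'_vis ▸ hz), coords_eq_iff.1 ?_, ?_, ?_⟩
  · rcases List.mem_append.1 (hq'_perm.mem_iff.1 ht) with ht | ht
    · exact hcT t ht
    · obtain ⟨w, hw, ht⟩ := List.mem_flatten.1 ht
      exact hlsT w (hls' hw) t ht
  · rw [hq'_perm.sum_eq, hq_perm.sum_eq, List.sum_append, List.sum_append, map_add, map_add,
      map_sum_flatten_eq_zero fun w hw => (hls w hw).1,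
      map_sum_flatten_eq_zero fun w hw => (hls w (hls' hw)).1]
  · simpa only [hq_perm.sum_eq, hq'_perm.sum_eq] using htrunc
  · have hloops : ls'.flatten.length ≤ ls'.length * B ^ n := by
      rw [List.length_flatten]
      simpa using List.sum_le_card_nsmul (ls'.map List.length) (B ^ n) (by
        simpa using fun w hw => hls_len w (hls' hw))
    rw [hq'_perm.length_eq, List.length_append]
    exact add_le_add hc_len (hloops.trans (Nat.mul_le_mul_right _ hls'_len))

theorem StaysIn.exists_short_append (h : StaysIn J (Set.Ico 0 B) u (p ++ q)) (hB : 1 ≤ B)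
    (hT : 1 ≤ absMax T) (hp : ∀ t ∈ p, t ∈ T) (hq : ∀ t ∈ q, t ∈ T) (σ : ℕ) :
    ∃ p' q', (∀ t ∈ p', t ∈ T) ∧ (∀ t ∈ q', t ∈ T) ∧ StaysIn J (Set.Ico 0 B) u (p' ++ q') ∧
      (∀ j ∈ J, (p' ++ q').sum j = (p ++ q).sum j) ∧ (∀ j, TruncEq σ (q.sum j) (q'.sum j)) ∧
      (p' ++ q').length ≤ B ^ n + segmentBound n (absMax T) σ (B ^ n) := by
  obtain ⟨hpos_p, hpos_q⟩ := staysIn_append.1 h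
  obtain ⟨p', hp'_sub, hp'_pos, hp'_sum, hp'_len⟩ := hpos_p.exists_short_walk hB
  have hpos_q' : StaysIn J (Set.Ico 0 B) (u + p'.sum) q :=
    hpos_q.congr fun j hj => by rw [Pi.add_apply, Pi.add_apply, hp'_sum j hj]
  obtain ⟨q', hq'T, hq'_pos, hq'_sum, hq'_trunc, hq'_len⟩ :=
    hpos_q'.exists_short_segment hB hT hq σ
  refine ⟨p', q', fun t ht => hp t (hp'_sub.subset ht), hq'T,
    staysIn_append.2 ⟨hp'_pos, hq'_pos⟩, fun j hj => ?_, hq'_trunc, ?_⟩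
  · simp only [List.sum_append, Pi.add_apply, hp'_sum j hj, hq'_sum j hj]
  · rw [List.length_append]
    exact add_le_add hp'_len hq'_len

end Segments

/-! ### Induction on the constrained components -/

section Stages

variable {n : ℕ} {T : Finset (Fin n → ℤ)} {P : GenUnbProp n} {I I' M : Finset (Fin n)} {l : ℕ}
  {u u' : Fin n → ℤ} {p q r path : List (Fin n → ℤ)} {B G : ℕ}

theorem GenUnbProp.one_le_scale (P : GenUnbProp n) : 1 ≤ P.scale :=
  le_max_left _ _

theorem GenUnbProp.maxAbs_interval_le_scale (P : GenUnbProp n) (l : Finset.Icc 1 P.K) (j : Fin n) :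
    (P.interval l j).maxAbs ≤ P.scale :=
  ((Finset.le_sup (f := fun j => (P.interval l j).maxAbs) (Finset.mem_univ j)).trans
    (Finset.le_sup (f := fun l => Finset.univ.sup fun j => (P.interval l j).maxAbs)
      (Finset.mem_univ l))).trans (le_max_right _ _)

/-- The set of components exempt from the constraints after a stage of effect `d`, when those in `M`
were exempt before. -/
def release (M : Finset (Fin n)) (d : Fin n → ℤ) : Finset (Fin n) :=
  M ∪ Finset.univ.filter fun j => 0 < d j

@[simp]
theorem mem_release {d : Fin n → ℤ} {j : Fin n} : j ∈ release M d ↔ j ∈ M ∨ 0 < d j := by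
  simp [release]

theorem sdiff_release_subset (d : Fin n → ℤ) : I \ release M d ⊆ I \ M :=
  Finset.sdiff_subset_sdiff subset_rfl Finset.subset_union_left

/-- The path `path` of `T` leads from `u` through the stages `l + 1, …, K` of the property `P`,
where the components in `M` are exempt from the constraints. A stage consists of two segments `p`
and `q`, from `y_{2l}` to `y_{2l+1}` and from there to `y_{2l+2}`. This is
`PseudoRun.SatisfiesApprox` at `l + 1` with `INCR = M` and `B = ⊤`, unfolded stage by stage. -/
inductive Stages (T : Finset (Fin n → ℤ)) (P : GenUnbProp n) (I : Finset (Fin n)) :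
    ℕ → Finset (Fin n) → (Fin n → ℤ) → List (Fin n → ℤ) → Prop
  | done {M : Finset (Fin n)} {u : Fin n → ℤ} (hu : ∀ j ∈ I \ M, 0 ≤ u j) : Stages T P I P.K M u []
  | step {l : ℕ} {M : Finset (Fin n)} {u : Fin n → ℤ} {p q r : List (Fin n → ℤ)}
      (hl : l + 1 ∈ Finset.Icc 1 P.K) (hp : ∀ t ∈ p, t ∈ T) (hq : ∀ t ∈ q, t ∈ T)
      (hmem : ∀ j, q.sum j ∈ (P.interval ⟨l + 1, hl⟩ j).toSet) (hdec : ∀ j ∉ M, 0 ≤ q.sum j)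
      (hpos : StaysIn (I \ M) (Set.Ici 0) u (p ++ q))
      (hr : Stages T P I (l + 1) (release M q.sum) (u + (p ++ q).sum) r) :
      Stages T P I l M u (p ++ q ++ r)

/-- Any path through the remaining stages of `P`, from any start and with any set of exempt
components, can be replaced by one with fewer than `G` transitions. This is the statement proved by
induction on the number of components in `I`. -/
def HasShortPaths (T : Finset (Fin n → ℤ)) (P : GenUnbProp n) (I : Finset (Fin n)) (G : ℕ) : Prop :=
  ∀ ⦃l M u path⦄, Stages T P I l M u path →
    ∃ path', Stages T P I l M u path' ∧ path'.length < G

namespace Stages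

theorem mem_of_mem (h : Stages T P I l M u path) : ∀ t ∈ path, t ∈ T := by
  induction h with
  | done _ => simp
  | step _ hp hq _ _ _ _ ih =>
    simp only [List.forall_mem_append]
    exact ⟨⟨hp, hq⟩, ih⟩

theorem mono (h : Stages T P I l M u path) (hI : I' ⊆ I) (hu : ∀ j ∈ I' \ M, u j ≤ u' j) :
    Stages T P I' l M u' path := by
  induction h generalizing u' with
  | done hpos =>
    exact done fun j hj => (hpos j (Finset.sdiff_subset_sdiff hI le_rfl hj)).trans (hu j hj)
  | step hl hp hq hmem hdec hpos _ ih =>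
    exact step hl hp hq hmem hdec (hpos.mono (Finset.sdiff_subset_sdiff hI le_rfl) hu)
      (ih fun j hj => add_le_add_left (hu j (sdiff_release_subset _ hj)) _)

theorem of_erase {j₀ : Fin n} (h : Stages T P (I.erase j₀) l M u path)
    (hj₀ : (maxDec T * path.length : ℤ) ≤ u j₀) : Stages T P I l M u path := by
  induction h with
  | done hu =>
    refine done fun j hj => ?_
    by_cases h : j = j₀
    · simpa [h] using hj₀
    · exact hu j (by simp_all)
  | @step l M u p q r hl hp hq hmem hdec hpos hr ih =>
    have hpq : ∀ t ∈ p ++ q, t ∈ T := List.forall_mem_append.2 ⟨hp, hq⟩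
    simp only [List.length_append (bs := r), Nat.cast_add, mul_add] at hj₀
    refine step hl hp hq hmem hdec (staysIn_iff_forall_take.2 fun m hm j hj => ?_) (ih ?_)
    · by_cases h : j = j₀
      · subst h
        have hdrop : -(maxDec T * m : ℤ) ≤ ((p ++ q).take m).sum j := by
          simpa only [List.length_take_of_le hm.le] using neg_maxDec_mul_length_le_sum_apply
            (p := (p ++ q).take m) (fun t ht => hpq t (List.mem_of_mem_take ht)) j
        have hm' : (maxDec T * m : ℤ) ≤ maxDec T * (p ++ q).length := by gcongr
        simp only [Pi.add_apply, Set.mem_Ici]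
        have : (0 : ℤ) ≤ maxDec T * r.length := by positivity
        linarith
      · exact staysIn_iff_forall_take.1 hpos m hm j (by simp_all)
    · have := neg_maxDec_mul_length_le_sum_apply hpq j₀
      rw [Pi.add_apply]
      linarith

theorem prepend {a : List (Fin n → ℤ)} (h : Stages T P I l M (u + a.sum) path) (hl : l < P.K)
    (ha : ∀ t ∈ a, t ∈ T) (ha_pos : StaysIn (I \ M) (Set.Ici 0) u a) :
    Stages T P I l M u (a ++ path) := by
  cases h with
  | done hu => exact absurd hl (lt_irrefl _)
  | @step _ _ _ p q r hl hp hq hmem hdec hpos hr =>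
    have hstep : Stages T P I l M u ((a ++ p) ++ q ++ r) := by
      refine step hl (List.forall_mem_append.2 ⟨ha, hp⟩) hq hmem hdec ?_ ?_
      · rw [List.append_assoc]
        exact staysIn_append.2 ⟨ha_pos, hpos⟩
      · simpa [add_assoc] using hr
    simpa using hstep

theorem exists_restart {a b : List (Fin n → ℤ)} (hl : l + 1 ∈ Finset.Icc 1 P.K)
    (hp : ∀ t ∈ p, t ∈ T) (hq : ∀ t ∈ q, t ∈ T)
    (hmem : ∀ j, q.sum j ∈ (P.interval ⟨l + 1, hl⟩ j).toSet) (hdec : ∀ j ∉ M, 0 ≤ q.sum j)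
    (hpos : StaysIn (I \ M) (Set.Ici 0) u (p ++ q))
    (hr : Stages T P I (l + 1) (release M q.sum) (u + (p ++ q).sum) r) (hab : p ++ q = a ++ b) :
    ∃ path', Stages T P I l M (u + a.sum) path' := by
  rcases List.append_eq_append_iff.1 hab with ⟨c, rfl, rfl⟩ | ⟨c, rfl, rfl⟩
  · have hcb : ∀ j ∈ I \ M, 0 ≤ (c ++ b).sum j := fun j hj => hdec j (Finset.mem_sdiff.1 hj).2
    have hpos_b : StaysIn (I \ M) (Set.Ici 0) (u + (p ++ c).sum) b :=
      (staysIn_append.1 (hab ▸ hpos)).2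
    refine ⟨_, step (p := b) (q := c ++ b) (r := r) hl (fun t ht => hq t (by simp [ht])) hq hmem
      hdec (staysIn_append.2 ⟨hpos_b, (staysIn_append.1 hpos).2.mono subset_rfl fun j hj => ?_⟩)
      (hr.mono subset_rfl fun j hj => ?_)⟩
    · have := hcb j hj
      simp only [List.sum_append, Pi.add_apply] at this ⊢
      linarith
    · have := hcb j (sdiff_release_subset _ hj)
      simp only [List.sum_append, Pi.add_apply] at this ⊢
      linarith
  · refine ⟨_, step (p := c) (q := q) (r := r) hl (fun t ht => hp t (by simp [ht])) hq hmem hdec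
      ?_ ?_⟩
    · rw [List.append_assoc] at hpos
      exact (staysIn_append.1 hpos).2
    · simpa [add_assoc] using hr

theorem exists_short_of_le_apply {a : List (Fin n → ℤ)} {j₀ : Fin n}
    (h : Stages T P I l M (u + a.sum) path) (hl : l < P.K) (ha : ∀ t ∈ a, t ∈ T)
    (hpos : StaysIn (I \ M) (Set.Ico 0 B) u a) (hB : 1 ≤ B) (hj₀ : j₀ ∈ I \ M)
    (hBj₀ : B ≤ (u + a.sum) j₀) (hGB : maxDec T * G ≤ B)
    (hG : HasShortPaths T P (I.erase j₀) G) :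
    ∃ path', Stages T P I l M u path' ∧ path'.length < B ^ n + G := by
  obtain ⟨a', ha'_sub, ha'_pos, ha'_sum, ha'_len⟩ := hpos.exists_short_walk hB
  have hstart : ∀ j ∈ I \ M, (u + a'.sum) j = (u + a.sum) j := fun j hj => by
    rw [Pi.add_apply, Pi.add_apply, ha'_sum j hj]
  obtain ⟨b, hb, hb_len⟩ := hG <| h.mono (Finset.erase_subset j₀ I) fun j hj =>
    (hstart j (Finset.sdiff_subset_sdiff (Finset.erase_subset j₀ I) le_rfl hj)).ge
  have hb_dec : (maxDec T * b.length : ℤ) ≤ (u + a'.sum) j₀ := by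
    rw [hstart j₀ hj₀]
    exact le_trans (mod_cast (Nat.mul_le_mul_left _ hb_len.le).trans hGB) hBj₀
  refine ⟨a' ++ b, (hb.of_erase hb_dec).prepend hl (fun t ht => ha t (ha'_sub.subset ht))
    ha'_pos.of_Ico, ?_⟩
  rw [List.length_append]
  exact add_lt_add_of_le_of_lt ha'_len hb_len

theorem step_of_truncEq {p' q' : List (Fin n → ℤ)} (hl : l + 1 ∈ Finset.Icc 1 P.K)
    (hmem : ∀ j, q.sum j ∈ (P.interval ⟨l + 1, hl⟩ j).toSet) (hdec : ∀ j ∉ M, 0 ≤ q.sum j)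
    (hr : Stages T P I (l + 1) (release M q.sum) (u + (p ++ q).sum) r)
    (hp' : ∀ t ∈ p', t ∈ T) (hq' : ∀ t ∈ q', t ∈ T)
    (hpos : StaysIn (I \ M) (Set.Ici 0) u (p' ++ q'))
    (hsum : ∀ j ∈ I \ M, (p' ++ q').sum j = (p ++ q).sum j)
    (htrunc : ∀ j, TruncEq P.scale (q.sum j) (q'.sum j)) :
    Stages T P I l M u (p' ++ q' ++ r) := by
  have hrelease : release M q'.sum = release M q.sum := by
    ext j
    rw [mem_release, mem_release, (htrunc j).pos_iff]
  refine step hl hp' hq'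
    (fun j => ((htrunc j).mem_toSet_iff (P.maxAbs_interval_le_scale _ j)).1 (hmem j))
    (fun j hj => (htrunc j).nonneg_iff.1 (hdec j hj)) hpos ?_
  rw [hrelease]
  exact hr.mono subset_rfl fun j hj => by
    rw [Pi.add_apply, Pi.add_apply, hsum j (sdiff_release_subset _ hj)]

theorem exists_short_of_forall_erase (h : Stages T P I l M u path) (hT : 1 ≤ absMax T) (hB : 1 ≤ B)
    (hGB : maxDec T * G ≤ B) (hG : ∀ j ∈ I, HasShortPaths T P (I.erase j) G) :
    ∃ path', Stages T P I l M u path' ∧ path'.length <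
      (P.K - l) * (B ^ n + segmentBound n (absMax T) P.scale (B ^ n)) + (B ^ n + G) := by
  induction h with
  | done hu => exact ⟨[], done hu, by simp only [List.length_nil]; positivity⟩
  | @step l M u p q r hl hp hq hmem hdec hpos hr ih =>
    have hlK : l < P.K := (Finset.mem_Icc.1 hl).2
    rcases hpos.bounded_or_exits B with hbdd | ⟨a, b, hab, ha_pos, j₀, hj₀, hBj₀⟩
    · obtain ⟨p', q', hp', hq', hpos', hsum, htrunc, hlen⟩ :=
        hbdd.exists_short_append hB hT hp hq P.scale
      obtain ⟨r', hr', hr'_len⟩ := ih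
      refine ⟨_, step_of_truncEq hl hmem hdec hr' hp' hq' hpos'.of_Ico hsum htrunc, ?_⟩
      obtain ⟨k, hk⟩ : ∃ k, P.K - l = k + 1 := ⟨P.K - (l + 1), by omega⟩
      rw [show P.K - (l + 1) = k by omega] at hr'_len
      rw [List.length_append, hk, Nat.succ_mul]
      linarith
    · have haT : ∀ t ∈ a, t ∈ T := fun t ht =>
        List.forall_mem_append.2 ⟨hp, hq⟩ t (hab ▸ List.mem_append_left b ht)
      obtain ⟨rest, hrest⟩ := exists_restart hl hp hq hmem hdec hpos hr hab
      obtain ⟨path', hpath', hlen⟩ := hrest.exists_short_of_le_apply hlK haT ha_pos hB hj₀ hBj₀ hGB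
        (hG j₀ (Finset.mem_sdiff.1 hj₀).1)
      exact ⟨path', hpath', hlen.trans_le (Nat.le_add_left _ _)⟩

end Stages

theorem HasShortPaths.mono {G' : ℕ} (h : HasShortPaths T P I G) (hG : G ≤ G') :
    HasShortPaths T P I G' := fun _ _ _ _ hpath =>
  (h hpath).imp fun _ hpath' => ⟨hpath'.1, hpath'.2.trans_le hG⟩

theorem hasShortPaths_of_forall_erase (hT : 1 ≤ absMax T) (hB : 1 ≤ B) (hGB : maxDec T * G ≤ B)
    (hG : ∀ j ∈ I, HasShortPaths T P (I.erase j) G) :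
    HasShortPaths T P I
      (P.K * (B ^ n + segmentBound n (absMax T) P.scale (B ^ n)) + B ^ n + G) := by
  intro l M u path h
  obtain ⟨path', hpath', hlen⟩ := h.exists_short_of_forall_erase hT hB hGB hG
  refine ⟨path', hpath', hlen.trans_le ?_⟩
  rw [add_assoc]
  gcongr
  exact Nat.sub_le _ _

end Stages

/-! ### The bound -/

section Numerics

variable {n τ σ B X : ℕ}

theorem four_mul_add_nine_le_sixteen_pow (hn : 1 ≤ n) : 4 * n + 9 ≤ 16 ^ n := by
  induction n, hn using Nat.le_induction with
  | base => norm_num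
  | succ n _ ih => rw [pow_succ]; omega

theorem loop_count_base_le_pow (hn : 1 ≤ n) (hτ : 1 ≤ τ) (hσ : 1 ≤ σ) (hB : 1 ≤ B)
    (hX : 4 * (τ * σ * B) ≤ X) :
    2 * (σ + 1 + τ * ((B ^ n + 1) * B ^ n) + 2 * (τ * B ^ n) * n) + 1 ≤ X ^ (2 * n) := by
  set M := B ^ n with hM_def
  have hM : 1 ≤ M := Nat.one_le_pow _ _ hB
  have : 1 ≤ τ * σ := Nat.mul_pos hτ hσ
  set Q := τ * σ * M ^ 2 with hQ
  have hσQ : σ ≤ Q := by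
    calc σ = 1 * σ * 1 ^ 2 := by ring
      _ ≤ τ * σ * M ^ 2 := by gcongr
  have hτQ : τ * M ^ 2 ≤ Q := by
    calc τ * M ^ 2 = τ * 1 * M ^ 2 := by ring
      _ ≤ τ * σ * M ^ 2 := by gcongr
  have hτM : τ * M ≤ τ * M ^ 2 := Nat.mul_le_mul_left _ (Nat.le_self_pow two_ne_zero M)
  calc 2 * (σ + 1 + τ * ((M + 1) * M) + 2 * (τ * M) * n) + 1
      = 2 * (σ + 1 + (τ * M ^ 2 + τ * M) + 2 * (τ * M) * n) + 1 := by ring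
    _ ≤ 2 * (Q + Q + (Q + Q) + 2 * Q * n) + Q := by gcongr <;> omega
    _ = (4 * n + 9) * Q := by ring
    _ ≤ 16 ^ n * Q := by gcongr; exact four_mul_add_nine_le_sixteen_pow hn
    _ = 4 ^ (2 * n) * (τ * σ) * B ^ (2 * n) := by rw [hQ, hM_def, pow_mul 4]; ring
    _ ≤ 4 ^ (2 * n) * (τ * σ) ^ (2 * n) * B ^ (2 * n) := by
      gcongr
      exact Nat.le_self_pow (by omega) _
    _ = (4 * (τ * σ * B)) ^ (2 * n) := by ring
    _ ≤ X ^ (2 * n) := by gcongr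

theorem segmentBound_le_pow (hn : 1 ≤ n) (hτ : 1 ≤ τ) (hσ : 1 ≤ σ) (hB : 1 ≤ B)
    (hX : 4 * (τ * σ * B) ≤ X) : segmentBound n τ σ (B ^ n) ≤ 3 * X ^ (2 * n ^ 2 + n) := by
  have hBX : B ≤ X := by nlinarith [Nat.mul_pos hτ hσ]
  have hX_pos : 1 ≤ X := hB.trans hBX
  calc segmentBound n τ σ (B ^ n)
      ≤ (X ^ n + X ^ n) * X ^ n + (X ^ (2 * n)) ^ n * X ^ n := by
        unfold segmentBound
        gcongr
        · exact Nat.one_le_pow _ _ hX_pos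
        · exact loop_count_base_le_pow hn hτ hσ hB hX
    _ = 2 * X ^ (2 * n) + X ^ (2 * n ^ 2 + n) := by ring
    _ ≤ 2 * X ^ (2 * n ^ 2 + n) + X ^ (2 * n ^ 2 + n) := by
      gcongr 2 * ?_ + _
      exact Nat.pow_le_pow_right hX_pos (by nlinarith)
    _ = 3 * X ^ (2 * n ^ 2 + n) := by ring

theorem mul_segmentBound_le_pow {K : ℕ} (hn : 2 ≤ n) (hK : 1 ≤ K) (hτ : 1 ≤ τ) (hσ : 1 ≤ σ)
    (hB : 1 ≤ B) : K * (B ^ n + segmentBound n τ σ (B ^ n)) + B ^ n ≤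
      (2 * ((1 + K) * τ * σ) * B) ^ n ^ 4 := by
  set X := 2 * ((1 + K) * τ * σ) * B with hX_def
  have hτσB : 1 ≤ τ * σ * B := Nat.mul_pos (Nat.mul_pos hτ hσ) hB
  have hX_eq : X = 2 * (1 + K) * (τ * σ * B) := by rw [hX_def]; ring
  have hX : 4 * (τ * σ * B) ≤ X := by rw [hX_eq]; gcongr; omega
  have hKX : 1 + K ≤ X := by nlinarith
  have hBX : B ≤ X := by nlinarith [Nat.mul_pos hτ hσ]
  have hB_pow : B ^ n ≤ X ^ (2 * n ^ 2 + n) :=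
    (Nat.pow_le_pow_left hBX n).trans (Nat.pow_le_pow_right (by omega) (by omega))
  calc K * (B ^ n + segmentBound n τ σ (B ^ n)) + B ^ n
      ≤ K * (X ^ (2 * n ^ 2 + n) + 3 * X ^ (2 * n ^ 2 + n)) + 4 * X ^ (2 * n ^ 2 + n) := by
        gcongr
        · exact segmentBound_le_pow (by omega) hτ hσ hB hX
        · omega
    _ = (1 + K) * 4 * X ^ (2 * n ^ 2 + n) := by ring
    _ ≤ X * X * X ^ (2 * n ^ 2 + n) := by gcongr; omega
    _ = X ^ (2 * n ^ 2 + n + 2) := by ring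
    _ ≤ X ^ n ^ 4 := Nat.pow_le_pow_right (by omega) (by nlinarith [Nat.pow_le_pow_left hn 2])

theorem one_le_g {T : Finset (Fin n → ℤ)} (hT : 1 ≤ absMax T) (P : GenUnbProp n) (C i : ℕ) :
    1 ≤ g C T P i := by
  induction i with
  | zero =>
    have hmu : 1 ≤ mu T P := Nat.mul_pos (Nat.mul_pos (by omega) hT) P.one_le_scale
    exact Nat.one_le_pow _ _ (by omega)
  | succ i ih => exact ih.trans (Nat.le_add_left _ _)

theorem hasShortPaths {T : Finset (Fin n → ℤ)} (hn : 2 ≤ n) (hT : 1 ≤ maxDec T)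
    (P : GenUnbProp n) (I : Finset (Fin n)) : HasShortPaths T P I (g 4 T P I.card) := by
  have hτ : 1 ≤ absMax T := hT.trans (maxDec_le_absMax T)
  have bound {B : ℕ} (hB : 1 ≤ B) := mul_segmentBound_le_pow hn P.one_le_K hτ P.one_le_scale hB
  induction hI : I.card generalizing I with
  | zero =>
    obtain rfl := Finset.card_eq_zero.1 hI
    refine (hasShortPaths_of_forall_erase (B := 1) (G := 0) hτ le_rfl (by simp) (by simp)).mono ?_
    simpa [g, mu] using bound le_rfl
  | succ i ih =>
    have hB : 1 ≤ maxDec T * g 4 T P i := Nat.mul_pos hT (one_le_g hτ P 4 i)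
    refine (hasShortPaths_of_forall_erase hτ hB le_rfl
      fun j hj => ih _ (by rw [Finset.card_erase_of_mem hj, hI, Nat.add_sub_cancel])).mono ?_
    exact Nat.add_le_add_right (bound hB) _

end Numerics

/-! ### Decompositions of pseudo-runs -/

section Decompositions

variable {n : ℕ} {T : Finset (Fin n → ℤ)} {P : GenUnbProp n} {I M : Finset (Fin n)} {K l l' : ℕ}
  {ρ ρ' : PseudoRun T} {f f' : ℕ → ℕ} {u : Fin n → ℤ} {p q path : List (Fin n → ℤ)}

namespace PseudoRun

/-- The components exempt from the constraints after stage `l'`, when those in `M` are exempt before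
stage `l + 1`. -/
def exempt (ρ : PseudoRun T) (f : ℕ → ℕ) (l : ℕ) (M : Finset (Fin n)) (l' : ℕ) : Finset (Fin n) :=
  M ∪ (Finset.Icc (l + 1) l').biUnion fun l'' => Finset.univ.filter fun j => 0 < ρ.diff f l'' j

theorem mem_exempt {j : Fin n} :
    j ∈ ρ.exempt f l M l' ↔ j ∈ M ∨ ∃ l'' ∈ Finset.Icc (l + 1) l', 0 < ρ.diff f l'' j := by
  simp [exempt]

theorem exempt_self : ρ.exempt f l M l = M := by
  simp [exempt]

/-- The positions `f` witness `PseudoRun.SatisfiesApprox` for the stages `l + 1, …, K`, with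
`INCR = M` and `B = ⊤`. -/
structure IsWitness (ρ : PseudoRun T) (P : GenUnbProp n) (I : Finset (Fin n)) (l : ℕ)
    (M : Finset (Fin n)) (f : ℕ → ℕ) : Prop where
  isDecomposition : ρ.IsDecomposition (l + 1) P.K f
  diff_mem : ∀ l', l ≤ l' → ∀ (h : l' + 1 ∈ Finset.Icc 1 P.K) (j : Fin n),
    ρ.diff f (l' + 1) j ∈ (P.interval ⟨l' + 1, h⟩ j).toSet
  diff_nonneg : ∀ l', l ≤ l' → l' < P.K → ∀ j ∉ ρ.exempt f l M l', 0 ≤ ρ.diff f (l' + 1) j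
  config_nonneg : ∀ l', l ≤ l' → l' ≤ P.K → ∀ m ≤ ρ.path.length, f (2 * l') ≤ m →
    (l' < P.K → m < f (2 * l' + 2)) → ∀ j ∈ I \ ρ.exempt f l M l', 0 ≤ ρ.config m j

theorem satisfiesApprox_iff_exists_isWitness :
    ρ.SatisfiesApprox P (l + 1) M I ⊤ ↔ ∃ f, ρ.IsWitness P I l M f := by
  refine exists_congr fun f => ⟨fun ⟨hdecomp, hmem, hdec, hpos⟩ => ⟨hdecomp, ?_, ?_, ?_⟩,
    fun ⟨hdecomp, hmem, hdec, hpos⟩ => ⟨hdecomp, ?_, ?_, ?_⟩⟩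
  · exact fun l' hl' h => hmem (l' + 1) h (by omega)
  · intro l' hl' hl'K j hj
    by_contra! hneg
    rcases hdec (l' + 1) (by omega) hl'K j hneg with ⟨l'', h₁, h₂, h⟩ | hjM
    · exact hj (mem_exempt.2 (.inr ⟨l'', Finset.mem_Icc.2 ⟨h₁, by omega⟩, h⟩))
    · exact hj (mem_exempt.2 (.inl hjM))
  · intro l' hl' hl'K m hm hfm hmf j hj
    simp only [Finset.mem_sdiff, mem_exempt, not_or, Finset.mem_Icc, and_assoc] at hj
    exact (hpos l' hl' hl'K m hm hfm hmf j hj.1 hj.2.1 hj.2.2).1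
  · intro l' h hl' j
    obtain ⟨l', rfl⟩ : ∃ k, l' = k + 1 := ⟨l' - 1, by omega⟩
    exact hmem l' (by omega) h j
  · intro l' hl' hl'K j hneg
    obtain ⟨l', rfl⟩ : ∃ k, l' = k + 1 := ⟨l' - 1, by omega⟩
    by_contra! hj
    refine hneg.not_ge (hdec l' (by omega) (by omega) j fun hmem => ?_)
    rcases mem_exempt.1 hmem with hjM | ⟨l'', hl'', h⟩
    · exact hj.2 hjM
    · rw [Finset.mem_Icc] at hl''
      exact (hj.1 l'' hl''.1 (by omega)).not_gt h
  · intro l' hl' hl'K m hm hfm hmf j hjI hjM hj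
    refine ⟨hpos l' hl' hl'K m hm hfm hmf j ?_, ENat.natCast_lt_top _⟩
    simp only [Finset.mem_sdiff, mem_exempt, not_or, Finset.mem_Icc, and_assoc]
    exact ⟨hjI, hjM, hj⟩

/-- `ρ` consists of the segments `p` and `q` of stage `l + 1` followed by `ρ'`, and the positions
`f` in `ρ` of the ends of the segments of the stages `l + 1, …, K` are given by the positions `f'`
in `ρ'`. -/
structure IsPrependStage (K l : ℕ) (p q : List (Fin n → ℤ)) (ρ ρ' : PseudoRun T) (f f' : ℕ → ℕ) :
    Prop where
  initial_eq : ρ'.initial = ρ.initial + (p ++ q).sum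
  path_eq : ρ.path = p ++ q ++ ρ'.path
  start : f (2 * l) = 0
  mid : f (2 * l + 1) = p.length
  start' : f' (2 * l + 2) = 0
  add : ∀ x, 2 * l + 2 ≤ x → x ≤ 2 * K → f x = (p ++ q).length + f' x

namespace IsPrependStage

theorem config_of_le (h : IsPrependStage K l p q ρ ρ' f f') {m : ℕ} (hm : m ≤ (p ++ q).length) :
    ρ.config m = ρ.initial + ((p ++ q).take m).sum := by
  rw [config, h.path_eq, List.take_append_of_le_length hm]

theorem config_add (h : IsPrependStage K l p q ρ ρ' f f') (m : ℕ) :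
    ρ.config ((p ++ q).length + m) = ρ'.config m := by
  rw [config, config, h.path_eq, List.take_length_add_append, List.sum_append, h.initial_eq,
    add_assoc]

theorem length_path (h : IsPrependStage K l p q ρ ρ' f f') :
    ρ.path.length = (p ++ q).length + ρ'.path.length := by
  rw [h.path_eq]
  exact List.length_append

theorem diff_first (h : IsPrependStage K l p q ρ ρ' f f') (hl : l < K) (j : Fin n) :
    ρ.diff f (l + 1) j = q.sum j := by
  rw [diff, show 2 * (l + 1) - 1 = 2 * l + 1 by omega, show 2 * (l + 1) = 2 * l + 2 by omega,
    h.mid, h.add _ le_rfl (by omega), h.start', add_zero, h.config_of_le le_rfl,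
    h.config_of_le (by simp), List.take_length, List.take_left]
  simp

theorem diff_succ (h : IsPrependStage K l p q ρ ρ' f f') (hl' : l + 1 < l') (hl'K : l' ≤ K)
    (j : Fin n) : ρ.diff f l' j = ρ'.diff f' l' j := by
  rw [diff, diff, h.add _ (by omega) (by omega), h.add _ (by omega) (by omega), h.config_add,
    h.config_add]

theorem exempt_eq (h : IsPrependStage K l p q ρ ρ' f f') (hl' : l + 1 ≤ l') (hl'K : l' ≤ K) :
    ρ.exempt f l M l' = ρ'.exempt f' (l + 1) (release M q.sum) l' := by
  ext j
  have htail : ∀ l'' ∈ Finset.Icc (l + 1 + 1) l', ρ.diff f l'' j = ρ'.diff f' l'' j :=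
    fun l'' hl'' => by
      rw [Finset.mem_Icc] at hl''
      exact h.diff_succ (by omega) (by omega) j
  rw [mem_exempt, mem_exempt, mem_release, ← Finset.insert_Icc_succ_left_eq_Icc hl',
    Finset.exists_mem_insert, h.diff_first (by omega), or_assoc]
  exact or_congr_right <| or_congr_right <| exists_congr fun l'' => and_congr_right fun hl'' => by
    rw [htail l'' hl'']

theorem isDecomposition_iff (h : IsPrependStage K l p q ρ ρ' f f') (hl : l < K) :
    ρ.IsDecomposition (l + 1) K f ↔ ρ'.IsDecomposition (l + 1 + 1) K f' := by
  have hlast : f (2 * K) = ρ.path.length ↔ f' (2 * K) = ρ'.path.length := by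
    rw [h.add _ (by omega) le_rfl, h.length_path, add_right_inj]
  have hmono : MonotoneOn f (Set.Icc (2 * l) (2 * K)) ↔
      MonotoneOn f' (Set.Icc (2 * l + 2) (2 * K)) := by
    refine ⟨fun hf x hx y hy hxy => ?_, fun hf' x hx y hy hxy => ?_⟩
    · have := hf ⟨by have := hx.1; omega, hx.2⟩ ⟨by have := hy.1; omega, hy.2⟩ hxy
      rwa [h.add x hx.1 hx.2, h.add y hy.1 hy.2, add_le_add_iff_left] at this
    · have hlen : p.length ≤ (p ++ q).length := by simp
      rcases le_or_gt (2 * l + 2) x with hx' | hx'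
      · rw [h.add x hx' hx.2, h.add y (hx'.trans hxy) hy.2]
        exact Nat.add_le_add_left (hf' ⟨hx', hx.2⟩ ⟨hx'.trans hxy, hy.2⟩ hxy) _
      · obtain ⟨hx₁, -⟩ := hx
        obtain ⟨hy₁, hy₂⟩ := hy
        obtain rfl | rfl : x = 2 * l ∨ x = 2 * l + 1 := by omega
        · exact h.start.trans_le (Nat.zero_le _)
        · rw [h.mid]
          rcases hxy.eq_or_lt with rfl | hxy
          · exact h.mid.ge
          · rw [h.add y hxy hy₂]
            exact hlen.trans (Nat.le_add_right _ _)
  rw [IsDecomposition, IsDecomposition, hlast, show 2 * (l + 1) - 2 = 2 * l by omega,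
    show 2 * (l + 1 + 1) - 2 = 2 * l + 2 by omega, hmono]
  simp only [h.start, h.start', true_and]

theorem isWitness_tail (h : IsPrependStage P.K l p q ρ ρ' f f') (hl : l < P.K)
    (w : ρ.IsWitness P I l M f) : ρ'.IsWitness P I (l + 1) (release M q.sum) f' where
  isDecomposition := (h.isDecomposition_iff hl).1 w.isDecomposition
  diff_mem l' hl' hl'K j := by
    rw [← h.diff_succ (by omega) (Finset.mem_Icc.1 hl'K).2]
    exact w.diff_mem l' (by omega) hl'K j
  diff_nonneg l' hl' hl'K j hj := by
    rw [← h.exempt_eq hl' hl'K.le] at hj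
    rw [← h.diff_succ (by omega) hl'K]
    exact w.diff_nonneg l' (by omega) hl'K j hj
  config_nonneg l' hl' hl'K m hm hfm hmf j hj := by
    rw [← h.exempt_eq hl' hl'K] at hj
    rw [← h.config_add]
    refine w.config_nonneg l' (by omega) hl'K _ ?_ ?_ (fun hlt => ?_) j hj
    · rw [h.length_path]
      exact Nat.add_le_add_left hm _
    · rw [h.add _ (by omega) (by omega)]
      exact Nat.add_le_add_left hfm _
    · rw [h.add _ (by omega) (by omega)]
      exact Nat.add_lt_add_left (hmf hlt) _

theorem isWitness_of_tail (h : IsPrependStage P.K l p q ρ ρ' f f') (hl : l + 1 ∈ Finset.Icc 1 P.K)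
    (hmem : ∀ j, q.sum j ∈ (P.interval ⟨l + 1, hl⟩ j).toSet) (hdec : ∀ j ∉ M, 0 ≤ q.sum j)
    (hpos : StaysIn (I \ M) (Set.Ici 0) ρ.initial (p ++ q))
    (w : ρ'.IsWitness P I (l + 1) (release M q.sum) f') : ρ.IsWitness P I l M f where
  isDecomposition := (h.isDecomposition_iff (Finset.mem_Icc.1 hl).2).2 w.isDecomposition
  diff_mem l' hl' hl'K j := by
    rcases hl'.eq_or_lt with rfl | hl'
    · rw [h.diff_first (Finset.mem_Icc.1 hl).2]
      exact hmem j
    · rw [h.diff_succ (by omega) (Finset.mem_Icc.1 hl'K).2]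
      exact w.diff_mem l' hl' hl'K j
  diff_nonneg l' hl' hl'K j hj := by
    rcases hl'.eq_or_lt with rfl | hl'
    · rw [exempt_self] at hj
      rw [h.diff_first hl'K]
      exact hdec j hj
    · rw [h.exempt_eq hl' hl'K.le] at hj
      rw [h.diff_succ (by omega) hl'K]
      exact w.diff_nonneg l' hl' hl'K j hj
  config_nonneg l' hl' hl'K m hm hfm hmf j hj := by
    rcases hl'.eq_or_lt with rfl | hl'
    · rw [exempt_self] at hj
      have hm : m < (p ++ q).length := by
        simpa only [h.add _ le_rfl (Nat.mul_le_mul_left 2 (Finset.mem_Icc.1 hl).2), h.start',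
          add_zero] using hmf (Finset.mem_Icc.1 hl).2
      rw [h.config_of_le hm.le]
      exact staysIn_iff_forall_take.1 hpos m hm j hj
    · rw [h.exempt_eq hl' hl'K] at hj
      rw [h.add _ (by omega) (by omega)] at hfm
      obtain ⟨m, rfl⟩ := Nat.exists_eq_add_of_le ((Nat.le_add_right _ _).trans hfm)
      rw [h.length_path] at hm
      rw [h.config_add]
      refine w.config_nonneg l' hl' hl'K m (by omega) (by omega) (fun hlt => ?_) j hj
      have := hmf hlt
      rw [h.add _ (by omega) (by omega)] at this
      omega

theorem stages (h : IsPrependStage P.K l p q ρ ρ' f f') (hl : l < P.K)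
    (w : ρ.IsWitness P I l M f)
    (hr : Stages T P I (l + 1) (release M q.sum) ρ'.initial ρ'.path) :
    Stages T P I l M ρ.initial ρ.path := by
  have hlK : l + 1 ∈ Finset.Icc 1 P.K := Finset.mem_Icc.2 ⟨by omega, hl⟩
  have hend : f (2 * l + 2) = (p ++ q).length := by
    rw [h.add _ le_rfl (by omega), h.start', add_zero]
  have hT : ∀ t ∈ p ++ q, t ∈ T := fun t ht =>
    ρ.path_mem t (h.path_eq ▸ List.mem_append_left _ ht)
  obtain ⟨hp, hq⟩ := List.forall_mem_append.1 hT
  rw [h.initial_eq] at hr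
  rw [h.path_eq]
  refine .step hlK hp hq (fun j => ?_) (fun j hj => ?_) ?_ hr
  · rw [← h.diff_first hl]
    exact w.diff_mem l le_rfl hlK j
  · rw [← h.diff_first hl]
    exact w.diff_nonneg l le_rfl hl j (exempt_self.symm ▸ hj)
  · refine staysIn_iff_forall_take.2 fun m hm j hj => ?_
    rw [← h.config_of_le hm.le]
    refine w.config_nonneg l le_rfl hl.le m ?_ (h.start.trans_le (Nat.zero_le _))
      (fun _ => hend.symm ▸ hm) j (exempt_self.symm ▸ hj)
    rw [h.length_path]
    exact hm.le.trans (Nat.le_add_right _ _)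

end IsPrependStage

theorem IsDecomposition.exists_isPrependStage (h : ρ.IsDecomposition (l + 1) K f) (hl : l < K) :
    ∃ p q ρ' f', IsPrependStage K l p q ρ ρ' f f' := by
  obtain ⟨hstart, hlast, hmono⟩ := h
  rw [show 2 * (l + 1) - 2 = 2 * l by omega] at hstart hmono
  have hf {x y : ℕ} (hx : 2 * l ≤ x) (hxy : x ≤ y) (hy : y ≤ 2 * K) : f x ≤ f y :=
    hmono ⟨hx, hxy.trans hy⟩ ⟨hx.trans hxy, hy⟩ hxy
  set a := f (2 * l + 1)
  set b := f (2 * l + 2)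
  have hab : a ≤ b := hf (by omega) (by omega) (by omega)
  have hb_len : b ≤ ρ.path.length := hlast ▸ hf (by omega) (by omega) le_rfl
  have hsplit : (ρ.path.take b).take a ++ (ρ.path.take b).drop a = ρ.path.take b :=
    List.take_append_drop a _
  refine ⟨(ρ.path.take b).take a, (ρ.path.take b).drop a,
    ⟨ρ.config b, ρ.path.drop b, fun t ht => ρ.path_mem t (List.mem_of_mem_drop ht)⟩,
    fun x => f x - b, ?_, ?_, hstart, ?_, Nat.sub_self _, fun x hx hxK => ?_⟩
  · rw [hsplit, config]
  · rw [hsplit, List.take_append_drop]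
  · rw [List.length_take_of_le (by rwa [List.length_take_of_le hb_len])]
  · have := hf (by omega) hx hxK
    rw [hsplit, List.length_take_of_le hb_len]
    omega

theorem exists_isPrependStage (hinitial : ρ'.initial = ρ.initial + (p ++ q).sum)
    (hpath : ρ.path = p ++ q ++ ρ'.path) (hf' : f' (2 * l + 2) = 0) (K : ℕ) :
    ∃ f, IsPrependStage K l p q ρ ρ' f f' := by
  refine ⟨fun x => if x = 2 * l then 0 else if x = 2 * l + 1 then p.length else
    (p ++ q).length + f' x, hinitial, hpath, by simp, by simp, hf', fun x hx _ => ?_⟩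
  rw [if_neg (by omega), if_neg (by omega)]

theorem IsWitness.stages (w : ρ.IsWitness P I l M f) (hl : l ≤ P.K) :
    Stages T P I l M ρ.initial ρ.path := by
  obtain ⟨k, hk⟩ := Nat.exists_eq_add_of_le hl
  induction k generalizing l M ρ f with
  | zero =>
    obtain rfl : P.K = l := hk
    have hpath : ρ.path = [] := List.length_eq_zero_iff.1 <|
      w.isDecomposition.2.1.symm.trans w.isDecomposition.1
    rw [hpath]
    refine .done fun j hj => ?_
    simpa [config] using w.config_nonneg P.K le_rfl le_rfl 0 (Nat.zero_le _)
      w.isDecomposition.1.le (absurd · (lt_irrefl _)) j (exempt_self.symm ▸ hj)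
  | succ k ih =>
    have hlt : l < P.K := by omega
    obtain ⟨p, q, ρ', f', h⟩ := w.isDecomposition.exists_isPrependStage hlt
    exact h.stages hlt w (ih (h.isWitness_tail hlt w) hlt (by omega))

end PseudoRun

theorem Stages.exists_isWitness (h : Stages T P I l M u path) :
    ∃ f, PseudoRun.IsWitness ⟨u, path, h.mem_of_mem⟩ P I l M f := by
  induction h with
  | @done M u hu =>
    refine ⟨fun _ => 0, ⟨rfl, rfl, monotoneOn_const⟩, fun l' hl' h => ?_, fun l' hl' h => ?_,
      fun l' hl' hl'K m _ _ _ j hj => ?_⟩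
    · have := (Finset.mem_Icc.1 h).2
      omega
    · omega
    · obtain rfl : l' = P.K := le_antisymm hl'K hl'
      rw [PseudoRun.exempt_self] at hj
      simpa [PseudoRun.config] using hu j hj
  | @step l M u p q r hl hp hq hmem hdec hpos hr ih =>
    obtain ⟨f', w⟩ := ih
    have hpath := (Stages.step hl hp hq hmem hdec hpos hr).mem_of_mem
    obtain ⟨f, hf⟩ := PseudoRun.exists_isPrependStage (ρ := ⟨u, p ++ q ++ r, hpath⟩)
      (ρ' := ⟨u + (p ++ q).sum, r, hr.mem_of_mem⟩) rfl rfl w.isDecomposition.1 P.K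
    exact ⟨f, hf.isWitness_of_tail hl hmem hdec hpos w⟩

end Decompositions

end VAS

theorem mainTheorem5 :
    ∃ C₁ : ℕ, ∀ (n : ℕ) (_ : 2 ≤ n) (T : Finset (Fin n → ℤ)) (_ : 1 ≤ VAS.maxDec T)
      (P : VAS.GenUnbProp n) (I INCR : Finset (Fin n)) (l : ℕ) (_ : 1 ≤ l) (_ : l ≤ P.K)
      (ρ : VAS.PseudoRun T), ρ.SatisfiesApprox P l INCR I ⊤ →
        ∃ ρ' : VAS.PseudoRun T, ρ'.initial = ρ.initial ∧ ρ'.SatisfiesApprox P l INCR I ⊤ ∧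
          ρ'.length ≤ VAS.g C₁ T P I.card := by
  refine ⟨4, fun n hn T hT P I INCR l hl hlK ρ hρ => ?_⟩
  obtain ⟨l, rfl⟩ := Nat.exists_eq_add_of_le' hl
  obtain ⟨f, hf⟩ := VAS.PseudoRun.satisfiesApprox_iff_exists_isWitness.1 hρ
  obtain ⟨path', hpath', hlength⟩ := VAS.hasShortPaths hn hT P I (hf.stages (by omega))
  exact ⟨⟨ρ.initial, path', hpath'.mem_of_mem⟩, rfl,
    VAS.PseudoRun.satisfiesApprox_iff_exists_isWitness.2 hpath'.exists_isWitness, hlength⟩
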